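/- Let $(\mathcal A,\varphi)$ be a non-commutative probability space: a von Neumann algebra (more generally, a unital C*-algebra) $\mathcal A$ with a state $\varphi$. The free cumulants $k_n\colon\mathcal A^n\to\mathbb C$ $(n\ge 1)$ are defined recursively by $$\varphi(a_1\cdots a_n)=\sum_{\pi\in NC(n)}\ \prod_{V=\{v_1<\dots<v_r\}\in\pi}k_{r}[a_{v_1},\dots,a_{v_r}],$$ where $NC(n)$ is the set of non-crossing partitions of $\{1,\dots,n\}$. Write $k_n(a)=k_n[a,\dots,a]$; the R-transform of $a$ is the power series $R_a(z)=\sum_{n\ge0}k_{n+1}(a)z^n$. Let $(\beta(t))_{t\in[0,1]}$ be a free Brownian bridge in $(\mathcal A,\varphi)$, i.e. a family of self-adjoint elements whose joint free cumulants of every order other than $2$ vanish and with $\varphi(\beta(s)\beta(t))=\min(s,t)-st$. If $\varphi$ is faithful, then $t\mapsto\beta(t)$ is norm continuous on $[0,1]$. Whenever $\beta$ is norm continuous on $[0,1]$ (whether or not $\varphi$ is faithful), the element $\Gamma=\int_0^1\beta(t)^2\,dt\in\mathcal A$ has the following properties. 1. For all $z\in\mathbb C$ with $0<|z|<\pi^2$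 the series $R_\Gamma(z)$ converges and $$R_\Gamma(z)=\frac{1-\sqrt z\,\cot\sqrt z}{2z},$$ for either choice of the square root. 2. For every $m\ge1$, $$k_m(\Gamma)=\frac{\zeta(2m)}{\pi^{2m}}=-\frac12\,(-4)^m\,\frac{B_{2m}}{(2m)!},$$ where $\zeta$ is the Riemann zeta function and $B_n$ are the Bernoulli numbers. 3. For every $n\ge0$, $$\varphi(\Gamma^n)=\frac1{\pi^{2n}}\sum_{\sigma\in NC(n)}\ \prod_{V\in\sigma}\zeta(2|V|)=(-4)^n\sum_{\sigma\in NC(n)}\ \prod_{V\in\sigma}\left(-\frac12\,\frac{B_{2|V|}}{(2|V|)!}\right).$$ -/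

import Mathlib

open scoped ComplexOrder

/-- A partition `π` of `{0, …, n - 1}` is non-crossing if there are no two distinct blocks
`V`, `W` and `x₁, y₁ ∈ V`, `x₂, y₂ ∈ W` with `x₁ < x₂ < y₁ < y₂`. -/
def IsNonCrossing {n : ℕ} (π : Finpartition (Finset.univ : Finset (Fin n))) : Prop :=
  ∀ V ∈ π.parts, ∀ W ∈ π.parts, V ≠ W →
    ¬ ∃ x₁ ∈ V, ∃ x₂ ∈ W, ∃ y₁ ∈ V, ∃ y₂ ∈ W, x₁ < x₂ ∧ x₂ < y₁ ∧ y₁ < y₂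

open Classical in
/-- The finite set `NC(n)` of non-crossing partitions of an `n`-element chain. -/
noncomputable def NC (n : ℕ) : Finset (Finpartition (Finset.univ : Finset (Fin n))) :=
  Finset.univ.filter IsNonCrossing

section NCProbability

variable {A : Type*} [CStarAlgebra A]

/-- A state on a unital C⋆-algebra: a positive linear functional with `φ 1 = 1`. -/
structure IsState (φ : A →L[ℂ] ℂ) : Prop where
  nonneg : ∀ a : A, 0 ≤ φ (star a * a)
  map_one : φ 1 = 1

/-- A positive functional is faithful if `φ (a* a) = 0` only for `a = 0`. -/
def IsFaithfulFunctional (φ : A →L[ℂ] ℂ) : Prop :=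
  ∀ a : A, φ (star a * a) = 0 → a = 0

open Classical in
/-- The free cumulants `k_n[a_1, …, a_n]`, obtained by solving the moment-cumulant formula
`φ (a_1 ⋯ a_n) = ∑ π ∈ NC(n), ∏ V ∈ π, k_{|V|}[a_v : v ∈ V]` inductively for the term of the
one-block partition. (In all the partitions in the sum below, every block has fewer than `n`
elements, so that the `else` branch is never used.) See `moment_eq_sum_freeCumulant`. -/
noncomputable def freeCumulant (φ : A →L[ℂ] ℂ) (n : ℕ) (a : Fin n → A) : ℂ :=
  φ (List.ofFn a).prod -
    ∑ π ∈ (NC n).filter (fun π => π.parts ≠ {Finset.univ}),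
      ∏ V ∈ π.parts,
        if _h : V.card < n then freeCumulant φ V.card (fun i => a (V.orderEmbOfFin rfl i)) else 0
termination_by n

theorem freeCumulant_block_eq (φ : A →L[ℂ] ℂ) {n m : ℕ} (a : Fin n → A) (V : Finset (Fin n))
    (h : V.card = m) :
    freeCumulant φ V.card (fun i => a (V.orderEmbOfFin rfl i)) =
      freeCumulant φ m (fun i => a (V.orderEmbOfFin h i)) := by
  subst h
  rfl

theorem freeCumulant_block_univ (φ : A →L[ℂ] ℂ) {n : ℕ} (a : Fin n → A) :
    freeCumulant φ (Finset.univ : Finset (Fin n)).card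
      (fun i => a ((Finset.univ : Finset (Fin n)).orderEmbOfFin rfl i)) = freeCumulant φ n a := by
  have h : (Finset.univ : Finset (Fin n)).card = n := by simp
  rw [freeCumulant_block_eq φ a _ h]
  have h2 : (fun i => i) = ⇑((Finset.univ : Finset (Fin n)).orderEmbOfFin h) :=
    Finset.orderEmbOfFin_unique h (fun _ => Finset.mem_univ _) strictMono_id
  rw [← h2]

/-- The moment-cumulant formula, which determines the free cumulants uniquely. -/
theorem moment_eq_sum_freeCumulant (φ : A →L[ℂ] ℂ) {n : ℕ} (hn : 1 ≤ n) (a : Fin n → A) :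
    φ (List.ofFn a).prod =
      ∑ π ∈ NC n, ∏ V ∈ π.parts,
        freeCumulant φ V.card (fun i => a (V.orderEmbOfFin rfl i)) := by
  classical
  have hne : (Finset.univ : Finset (Fin n)) ≠ ⊥ := by
    have : NeZero n := ⟨by omega⟩
    exact Finset.univ_nonempty.ne_empty
  have h1 : (NC n).filter (fun π => π.parts = {Finset.univ}) = {Finpartition.indiscrete hne} := by
    ext π
    simp only [Finset.mem_filter, Finset.mem_singleton, NC, Finset.mem_univ, true_and]
    constructor
    · rintro ⟨-, h⟩
      exact Finpartition.ext h
    · rintro rfl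
      refine ⟨?_, rfl⟩
      intro V hV W hW hVW
      simp only [Finpartition.indiscrete, Finset.mem_singleton] at hV hW
      exact absurd (hV.trans hW.symm) hVW
  rw [← Finset.sum_filter_add_sum_filter_not (NC n) (fun π => π.parts = {Finset.univ}), h1,
    Finset.sum_singleton]
  have h2 : ∏ V ∈ (Finpartition.indiscrete hne).parts,
      freeCumulant φ V.card (fun i => a (V.orderEmbOfFin rfl i)) = freeCumulant φ n a := by
    simp only [Finpartition.indiscrete, Finset.prod_singleton]
    exact freeCumulant_block_univ φ a
  rw [h2, freeCumulant]
  have h3 : ∀ π ∈ (NC n).filter (fun π => π.parts ≠ {Finset.univ}),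
      (∏ V ∈ π.parts, if _h : V.card < n then
        freeCumulant φ V.card (fun i => a (V.orderEmbOfFin rfl i)) else 0) =
      ∏ V ∈ π.parts, freeCumulant φ V.card (fun i => a (V.orderEmbOfFin rfl i)) := by
    intro π hπ
    refine Finset.prod_congr rfl fun V hV => ?_
    have hlt : V.card < n := by
      by_contra hcon
      have hVu : V = Finset.univ := by
        rw [← Finset.card_eq_iff_eq_univ, Fintype.card_fin]
        have := Finset.card_le_univ V
        rw [Fintype.card_fin] at this
        omega
      subst hVu
      refine (Finset.mem_filter.1 hπ).2 (Finset.eq_singleton_iff_unique_mem.2 ⟨hV, ?_⟩)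
      intro W hW
      by_contra hWV
      have hd := π.disjoint hW hV hWV
      have hWe : W = ∅ := disjoint_top.1 hd
      exact π.ne_bot hW hWe
    rw [dif_pos hlt]
  rw [Finset.sum_congr rfl h3]
  ring

/-- `k_n(a) = k_n[a, …, a]`. -/
noncomputable def freeCumulantOf (φ : A →L[ℂ] ℂ) (n : ℕ) (a : A) : ℂ :=
  freeCumulant φ n (fun _ => a)

/-- The R-transform of `a`: the formal power series `∑ₙ k_{n+1}(a) zⁿ`. -/
noncomputable def rTransform (φ : A →L[ℂ] ℂ) (a : A) : PowerSeries ℂ :=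
  PowerSeries.mk fun n => freeCumulantOf φ (n + 1) a

/-- A (centred) semicircular family with covariance `c`: self-adjoint variables whose only
non-vanishing joint free cumulants are those of order two, and these are given by `c`. -/
structure IsSemicircularFamily {ι : Type*} (φ : A →L[ℂ] ℂ) (s : ι → A) (c : ι → ι → ℂ) :
    Prop where
  selfAdjoint : ∀ i, IsSelfAdjoint (s i)
  cumulant_two : ∀ i j, freeCumulant φ 2 ![s i, s j] = c i j
  cumulant_ne_two : ∀ n : ℕ, 1 ≤ n → n ≠ 2 → ∀ j : Fin n → ι,
    freeCumulant φ n (fun p => s (j p)) = 0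

/-- A centred semicircular process indexed by the times in `I`: all its finite-dimensional
marginals are semicircular families. -/
def IsSemicircularProcess (φ : A →L[ℂ] ℂ) (I : Set ℝ) (X : ℝ → A) : Prop :=
  ∀ (n : ℕ) (t : Fin n → ℝ), (∀ p, t p ∈ I) →
    IsSemicircularFamily φ (fun p => X (t p)) (fun p q => φ (X (t p) * X (t q)))

/-- A free Brownian bridge on `[0, T]`; the values of `β` outside `[0, T]` play no role. -/
structure IsFreeBrownianBridge (φ : A →L[ℂ] ℂ) (T : ℝ) (β : ℝ → A) : Prop where
  semicircular : IsSemicircularProcess φ (Set.Icc 0 T) β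
  covariance : ∀ s ∈ Set.Icc (0 : ℝ) T, ∀ t ∈ Set.Icc (0 : ℝ) T,
    φ (β s * β t) = ((min s t - s * t / T : ℝ) : ℂ)

/-- `∫₀¹ β(t)² dt`, for (norm) continuous `β` on `[0, 1]`. -/
noncomputable def squareNorm (β : ℝ → A) : A := ∫ t in (0 : ℝ)..1, β t ^ 2

end NCProbability

/-! ### Non-crossing partitions of finite chains: splitting off the minimum -/

section NonCrossing

/-! Heuristically, the bridge has a Karhunen-Loève expansion with eigenvalues `λ_j = 1 / (π (j +
1))²`, and `Γ = ∑ λ_j S_j²` with free standard semicircular `S_j`. All free cumulants of `S_j²` are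
`1`, so `k_m(Γ) = ∑ λ_j ^ m`, which is `spectralSum m = ζ(2m) / π^(2m)`. The proof reaches this
without using freeness, by comparing two recursions.

Analytic side. For a semicircular process, `φ (X_s w)` is the sum over the contractions of `X_s`
with a letter of `w`, each cutting the word in two (`apply_mul_prod_map`). Averaging over pairs of
equal adjacent letters extends this Schwinger-Dyson equation to words containing `Γ`
(`apply_mul_lettersProd`). Contracting `β_s` with a letter `Γ` leaves `(Kβ)_s` on one side of the
cut, where `K` is the covariance operator. Let `e_j` be the eigenfunctions, `Z_j = ∫ e_j β`, `M n =
φ (Γⁿ)` and `W_j n = φ (Z_j Γⁿ Z_j)`. Diagonalising `K` gives `M (n + 1) = (∑ λ_j) M n + ∑ k < n, M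
k * ∑ λ_j W_j (n - 1 - k)` and `W_j n = λ_j M n + ∑ k < n, M k * λ_j W_j (n - 1 - k)`. The sums `t r
n = ∑ λ_j ^ r W_j n` therefore satisfy a closed system whose coefficients are the power sums of the
`λ_j`.

Combinatorial side. Sums over non-crossing partitions with block weights `κ |V|` obey the same
system: remove the minimum and let the next element of its block take its place, with `r` counting
the elements of that block already removed (`ncSumAt_insert`, `ncSum_Ico_card`). So the moments have
the moment-cumulant form with `κ = spectralSum`, and `freeCumulantOf_eq_of_moments` identifies the
cumulants.

The R-transform is then `∑ λ_j / (1 - λ_j z)`, the partial fraction expansion of the cotangent. Norm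
continuity for faithful `φ` holds because increments have Catalan moments, and in a faithful state
the growth of the even moments bounds the norm. -/

/-- `P` is the set of blocks of a non-crossing partition of the finite set `S`. -/
structure IsNCBlocks {α : Type*} [LinearOrder α] (S : Finset α) (P : Finset (Finset α)) : Prop where
  nonempty : ∀ V ∈ P, V.Nonempty
  subset : ∀ V ∈ P, V ⊆ S
  cover : ∀ x ∈ S, ∃ V ∈ P, x ∈ V
  eq_of_mem : ∀ V ∈ P, ∀ W ∈ P, ∀ x ∈ V, x ∈ W → V = W
  noncrossing : ∀ V ∈ P, ∀ W ∈ P, ∀ x₁ ∈ V, ∀ x₂ ∈ W, ∀ y₁ ∈ V, ∀ y₂ ∈ W,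
    x₁ < x₂ → x₂ < y₁ → y₁ < y₂ → V = W

open Classical in
/-- The block sets of the non-crossing partitions of `S`. -/
noncomputable def ncBlocks {α : Type*} [LinearOrder α] (S : Finset α) :
    Finset (Finset (Finset α)) :=
  S.powerset.powerset.filter (IsNCBlocks S)

theorem mem_ncBlocks {α : Type*} [LinearOrder α] {S : Finset α} {P : Finset (Finset α)} :
    P ∈ ncBlocks S ↔ IsNCBlocks S P := by
  classical
  simp only [ncBlocks, Finset.mem_filter, Finset.mem_powerset, and_iff_right_iff_imp]
  intro h V hV
  exact Finset.mem_powerset.2 (h.subset V hV)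

/-- The sum over non-crossing partitions of `S` of the product of the block weights, where the
block containing `a` has weight `g` and the other blocks have weight `f`. -/
noncomputable def ncSumAt {α : Type*} [LinearOrder α] (a : α) (g f : Finset α → ℂ)
    (S : Finset α) : ℂ :=
  ∑ P ∈ ncBlocks S, ∏ V ∈ P, if a ∈ V then g V else f V

/-- The sum over non-crossing partitions of `S` of the product of the block weights. -/
noncomputable def ncSum {α : Type*} [LinearOrder α] (f : Finset α → ℂ) (S : Finset α) : ℂ :=
  ∑ P ∈ ncBlocks S, ∏ V ∈ P, f V

theorem ncSumAt_self {α : Type*} [LinearOrder α] (a : α) (f : Finset α → ℂ) (S : Finset α) :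
    ncSumAt a f f S = ncSum f S := by
  simp [ncSumAt, ncSum]

theorem ncBlocks_empty {α : Type*} [LinearOrder α] : ncBlocks (∅ : Finset α) = {∅} := by
  ext P
  rw [mem_ncBlocks, Finset.mem_singleton]
  constructor
  · intro h
    refine Finset.eq_empty_of_forall_notMem fun V hV => ?_
    have h1 := h.subset V hV
    rw [Finset.subset_empty] at h1
    exact (h.nonempty V hV).ne_empty h1
  · rintro rfl
    constructor <;> simp

theorem ncSum_empty {α : Type*} [LinearOrder α] (f : Finset α → ℂ) : ncSum f ∅ = 1 := by
  simp [ncSum, ncBlocks_empty]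

theorem ncSumAt_congr {α : Type*} [LinearOrder α] {a : α} {g g' f f' : Finset α → ℂ}
    {S : Finset α} (hg : ∀ V ⊆ S, a ∈ V → g V = g' V) (hf : ∀ V ⊆ S, V.Nonempty → f V = f' V) :
    ncSumAt a g f S = ncSumAt a g' f' S := by
  refine Finset.sum_congr rfl fun P hP => Finset.prod_congr rfl fun V hV => ?_
  rw [mem_ncBlocks] at hP
  split_ifs with h
  · exact hg V (hP.subset V hV) h
  · exact hf V (hP.subset V hV) (hP.nonempty V hV)

theorem ncSumAt_eq_zero {α : Type*} [LinearOrder α] {a : α} {g f : Finset α → ℂ}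
    {S : Finset α} (ha : a ∈ S) (hg : ∀ V ⊆ S, a ∈ V → g V = 0) :
    ncSumAt a g f S = 0 := by
  refine Finset.sum_eq_zero fun P hP => ?_
  rw [mem_ncBlocks] at hP
  obtain ⟨V, hV, haV⟩ := hP.cover a ha
  refine Finset.prod_eq_zero hV ?_
  rw [if_pos haV, hg V (hP.subset V hV) haV]

/-- Adding the singleton `{a}` to a non-crossing partition. -/
theorem IsNCBlocks.insert_singleton {α : Type*} [LinearOrder α] {a : α} {S : Finset α}
    {Q : Finset (Finset α)} (ha : a ∉ S) (hQ : IsNCBlocks S Q) :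
    IsNCBlocks (insert a S) (insert {a} Q) := by
  have hna : ∀ V ∈ Q, a ∉ V := fun V hV h => ha (hQ.subset V hV h)
  constructor
  · intro V hV
    rcases Finset.mem_insert.1 hV with rfl | hV
    · simp
    · exact hQ.nonempty V hV
  · intro V hV
    rcases Finset.mem_insert.1 hV with rfl | hV
    · simp
    · exact (hQ.subset V hV).trans (Finset.subset_insert _ _)
  · intro x hx
    rcases Finset.mem_insert.1 hx with rfl | hx
    · exact ⟨{x}, by simp, by simp⟩
    · obtain ⟨V, hV, h⟩ := hQ.cover x hx
      exact ⟨V, by simp [hV], h⟩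
  · intro V hV W hW x hxV hxW
    rcases Finset.mem_insert.1 hV with rfl | hV <;> rcases Finset.mem_insert.1 hW with rfl | hW
    · rfl
    · exact absurd ((Finset.mem_singleton.1 hxV) ▸ hxW) (hna W hW)
    · exact absurd ((Finset.mem_singleton.1 hxW) ▸ hxV) (hna V hV)
    · exact hQ.eq_of_mem V hV W hW x hxV hxW
  · intro V hV W hW x₁ hx₁ x₂ hx₂ y₁ hy₁ y₂ hy₂ h1 h2 h3
    rcases Finset.mem_insert.1 hV with rfl | hV <;> rcases Finset.mem_insert.1 hW with rfl | hW
    · rfl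
    · rw [Finset.mem_singleton] at hx₁ hy₁
      subst hx₁; subst hy₁
      exact absurd (h1.trans h2) (lt_irrefl _)
    · rw [Finset.mem_singleton] at hx₂ hy₂
      subst hx₂; subst hy₂
      exact absurd (h2.trans h3) (lt_irrefl _)
    · exact hQ.noncrossing V hV W hW x₁ hx₁ x₂ hx₂ y₁ hy₁ y₂ hy₂ h1 h2 h3

/-- Removing the singleton `{a}` from a non-crossing partition. -/
theorem IsNCBlocks.erase_singleton {α : Type*} [LinearOrder α] {a : α} {S : Finset α}
    {P : Finset (Finset α)} (hP : IsNCBlocks (insert a S) P) (haP : {a} ∈ P) (ha : a ∉ S) :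
    IsNCBlocks S (P.erase {a}) := by
  have hna : ∀ V ∈ P, V ≠ {a} → a ∉ V := fun V hV h h' =>
    h (hP.eq_of_mem V hV _ haP a h' (by simp))
  constructor
  · exact fun V hV => hP.nonempty V (Finset.mem_of_mem_erase hV)
  · intro V hV
    obtain ⟨h1, h2⟩ := Finset.mem_erase.1 hV
    exact (Finset.subset_insert_iff_of_notMem (hna V h2 h1)).1 (hP.subset V h2)
  · intro x hx
    obtain ⟨V, hV, h⟩ := hP.cover x (by simp [hx])
    refine ⟨V, Finset.mem_erase.2 ⟨?_, hV⟩, h⟩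
    rintro rfl
    rw [Finset.mem_singleton] at h
    exact ha (h ▸ hx)
  · exact fun V hV W hW => hP.eq_of_mem V (Finset.mem_of_mem_erase hV) W (Finset.mem_of_mem_erase hW)
  · exact fun V hV W hW =>
      hP.noncrossing V (Finset.mem_of_mem_erase hV) W (Finset.mem_of_mem_erase hW)

theorem sum_ncBlocks_singleton_mem {α : Type*} [LinearOrder α] {a : α} {S : Finset α}
    (ha : a ∉ S) (g f : Finset α → ℂ) :
    ∑ P ∈ (ncBlocks (insert a S)).filter (fun P => {a} ∈ P),
      ∏ V ∈ P, (if a ∈ V then g V else f V) = g {a} * ncSum f S := by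
  rw [ncSum, Finset.mul_sum]
  symm
  refine Finset.sum_bij' (fun Q _ => insert {a} Q) (fun P _ => P.erase {a}) ?_ ?_ ?_ ?_ ?_
  · intro Q hQ
    rw [mem_ncBlocks] at hQ
    simp only [Finset.mem_filter, mem_ncBlocks]
    exact ⟨hQ.insert_singleton ha, by simp⟩
  · intro P hP
    simp only [Finset.mem_filter, mem_ncBlocks] at hP ⊢
    exact hP.1.erase_singleton hP.2 ha
  · intro Q hQ
    rw [mem_ncBlocks] at hQ
    exact Finset.erase_insert fun h => ha (hQ.subset _ h (by simp))
  · intro P hP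
    exact Finset.insert_erase (Finset.mem_filter.1 hP).2
  · intro Q hQ
    rw [mem_ncBlocks] at hQ
    rw [Finset.prod_insert fun h => ha (hQ.subset _ h (by simp))]
    simp only [Finset.mem_singleton, if_true]
    congr 1
    refine Finset.prod_congr rfl fun V hV => ?_
    rw [if_neg fun h => ha (hQ.subset V hV h)]

/-- Joining `a` to the block of `k`. -/
def joinBlock {α : Type*} [LinearOrder α] (a k : α) (U : Finset α) : Finset α :=
  if k ∈ U then insert a U else U

/-- In the block set `P`, the elements `a` and `k` belong to the same block, and `k` is the
smallest element of this block other than `a`. -/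
def IsNextIn {α : Type*} [LinearOrder α] (a k : α) (P : Finset (Finset α)) : Prop :=
  ∃ V ∈ P, a ∈ V ∧ k ∈ V ∧ ∀ x ∈ V, x = a ∨ k ≤ x

theorem joinBlock_erase {α : Type*} [LinearOrder α] {a k : α} {U : Finset α} (ha : a ∉ U) :
    (joinBlock a k U).erase a = U := by
  unfold joinBlock
  split_ifs
  · exact Finset.erase_insert ha
  · exact Finset.erase_eq_of_notMem ha

theorem subset_joinBlock {α : Type*} [LinearOrder α] {a k : α} {U : Finset α} :
    U ⊆ joinBlock a k U := by
  unfold joinBlock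
  split_ifs
  · exact Finset.subset_insert _ _
  · exact subset_rfl

theorem mem_joinBlock {α : Type*} [LinearOrder α] {a k x : α} {U : Finset α} :
    x ∈ joinBlock a k U ↔ x ∈ U ∨ (x = a ∧ k ∈ U) := by
  unfold joinBlock
  split_ifs with h <;> simp [h, or_comm]

/-- Since `a` lies below all of `S`, it can only be the first point of a crossing, and there `k` can
stand in for it, being the least element of the upper part. Blocks of the lower part end before `k`,
so they cannot cross the upper ones. -/
theorem IsNCBlocks.join {α : Type*} [LinearOrder α] {a k : α} {S : Finset α}
    (ha : ∀ x ∈ S, a < x) (hk : k ∈ S) {Q₁ Q₂ : Finset (Finset α)}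
    (h₁ : IsNCBlocks (S.filter (· < k)) Q₁) (h₂ : IsNCBlocks (S.filter (k ≤ ·)) Q₂) :
    IsNCBlocks (insert a S) (Q₁ ∪ Q₂.image (joinBlock a k)) := by
  have m₁ : ∀ V ∈ Q₁, ∀ x ∈ V, x ∈ S ∧ x < k := fun V hV x hx =>
    Finset.mem_filter.1 (h₁.subset V hV hx)
  have m₂ : ∀ V ∈ Q₂, ∀ x ∈ V, x ∈ S ∧ k ≤ x := fun V hV x hx =>
    Finset.mem_filter.1 (h₂.subset V hV hx)
  constructor
  · intro V hV
    simp only [Finset.mem_union, Finset.mem_image] at hV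
    rcases hV with hV | ⟨U, hU, rfl⟩
    · exact h₁.nonempty V hV
    · exact (h₂.nonempty U hU).mono subset_joinBlock
  · intro V hV x hx
    simp only [Finset.mem_union, Finset.mem_image] at hV
    rw [Finset.mem_insert]
    rcases hV with hV | ⟨U, hU, rfl⟩
    · exact Or.inr (m₁ V hV x hx).1
    · rcases mem_joinBlock.1 hx with h | h
      · exact Or.inr (m₂ U hU x h).1
      · exact Or.inl h.1
  · intro x hx
    rcases Finset.mem_insert.1 hx with rfl | hx
    · obtain ⟨U, hU, hkU⟩ := h₂.cover k (by simp [hk])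
      exact ⟨joinBlock x k U, Finset.mem_union_right _ (Finset.mem_image_of_mem _ hU),
        mem_joinBlock.2 (Or.inr ⟨rfl, hkU⟩)⟩
    · rcases lt_or_ge x k with h | h
      · obtain ⟨U, hU, hkU⟩ := h₁.cover x (by simp [hx, h])
        exact ⟨U, Finset.mem_union_left _ hU, hkU⟩
      · obtain ⟨U, hU, hkU⟩ := h₂.cover x (by simp [hx, h])
        exact ⟨_, Finset.mem_union_right _ (Finset.mem_image_of_mem _ hU), subset_joinBlock hkU⟩
  · intro V hV W hW x hxV hxW
    simp only [Finset.mem_union, Finset.mem_image] at hV hW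
    rcases hV with hV | ⟨V, hV, rfl⟩ <;> rcases hW with hW | ⟨W, hW, rfl⟩
    · exact h₁.eq_of_mem V hV W hW x hxV hxW
    · exfalso
      have hx := m₁ V hV x hxV
      rcases mem_joinBlock.1 hxW with h | h
      · exact absurd hx.2 (m₂ W hW x h).2.not_gt
      · exact absurd (ha x hx.1) (by rw [h.1]; exact lt_irrefl _)
    · exfalso
      have hx := m₁ W hW x hxW
      rcases mem_joinBlock.1 hxV with h | h
      · exact absurd hx.2 (m₂ V hV x h).2.not_gt
      · exact absurd (ha x hx.1) (by rw [h.1]; exact lt_irrefl _)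
    · rcases mem_joinBlock.1 hxV with h | h <;> rcases mem_joinBlock.1 hxW with h' | h'
      · rw [h₂.eq_of_mem V hV W hW x h h']
      · exact absurd (ha x (m₂ V hV x h).1) (by rw [h'.1]; exact lt_irrefl _)
      · exact absurd (ha x (m₂ W hW x h').1) (by rw [h.1]; exact lt_irrefl _)
      · rw [h₂.eq_of_mem V hV W hW k h.2 h'.2]
  · intro V hV W hW x₁ hx₁ x₂ hx₂ y₁ hy₁ y₂ hy₂ h1 h2 h3
    simp only [Finset.mem_union, Finset.mem_image] at hV hW
    rcases hV with hV | ⟨V, hV, rfl⟩ <;> rcases hW with hW | ⟨W, hW, rfl⟩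
    · exact h₁.noncrossing V hV W hW x₁ hx₁ x₂ hx₂ y₁ hy₁ y₂ hy₂ h1 h2 h3
    · exfalso
      have e1 := m₁ V hV x₁ hx₁
      have e2 := m₁ V hV y₁ hy₁
      rcases mem_joinBlock.1 hx₂ with h | h
      · exact absurd (h2.trans e2.2) (m₂ W hW _ h).2.not_gt
      · exact absurd (ha x₁ e1.1) (by rw [← h.1]; exact h1.not_gt)
    · exfalso
      have e1 := m₁ W hW x₂ hx₂
      have e2 := m₁ W hW y₂ hy₂
      rcases mem_joinBlock.1 hy₁ with h | h
      · exact absurd (h3.trans e2.2) (m₂ V hV _ h).2.not_gt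
      · exact absurd (ha x₂ e1.1) (by rw [← h.1]; exact h2.not_gt)
    -- A point with something smaller next to it in the pattern is not `a`, so it already belongs to
    -- the block before joining.
    · have key : ∀ U ∈ Q₂, ∀ x ∈ joinBlock a k U, ∀ y, y < x → (y = a ∨ y ∈ S) → x ∈ U := by
        intro U hU x hx y hyx hy
        rcases mem_joinBlock.1 hx with h | h
        · exact h
        · exfalso
          rw [h.1] at hyx
          rcases hy with hy | hy
          · exact absurd hyx (by rw [hy]; exact lt_irrefl _)
          · exact absurd hyx (ha y hy).not_gt
      have mS : ∀ U ∈ Q₂, ∀ x ∈ joinBlock a k U, x = a ∨ x ∈ S := by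
        intro U hU x hx
        rcases mem_joinBlock.1 hx with h | h
        · exact Or.inr (m₂ U hU x h).1
        · exact Or.inl h.1
      have e2 := key W hW x₂ hx₂ x₁ h1 (mS V hV _ hx₁)
      have e3 := key V hV y₁ hy₁ x₂ h2 (mS W hW _ hx₂)
      have e4 := key W hW y₂ hy₂ y₁ h3 (mS V hV _ hy₁)
      rcases mem_joinBlock.1 hx₁ with h | h
      · rw [h₂.noncrossing V hV W hW x₁ h x₂ e2 y₁ e3 y₂ e4 h1 h2 h3]
      -- Here `x₁ = a` and `k ∈ V`. As `k ≤ x₂`, either `x₂ = k` and the two blocks share `k`, or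
      -- `k` replaces `a` in the crossing.
      · rcases (m₂ W hW x₂ e2).2.eq_or_lt with h' | h'
        · rw [h₂.eq_of_mem V hV W hW k h.2 (h' ▸ e2)]
        · rw [h₂.noncrossing V hV W hW k h.2 x₂ e2 y₁ e3 y₂ e4 h' h2 h3]

/-- If `k` is next to `a`, then the blocks other than that of `a` do not mix the elements
smaller than `k` with the others. -/
theorem IsNCBlocks.split {α : Type*} [LinearOrder α] {a k : α} {S : Finset α}
    (ha : ∀ x ∈ S, a < x) {P : Finset (Finset α)}
    (hP : IsNCBlocks (insert a S) P) (hk : IsNextIn a k P) {V : Finset α} (hV : V ∈ P)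
    {x y : α} (hx : x ∈ V) (hxk : x < k) (hxa : x ≠ a) (hy : y ∈ V) : y < k ∧ y ≠ a := by
  obtain ⟨U, hU, haU, hkU, hmin⟩ := hk
  have hVU : V ≠ U := by
    rintro rfl
    rcases hmin x hx with h | h
    · exact hxa h
    · exact absurd hxk h.not_gt
  have hya : y ≠ a := fun h => hVU (hP.eq_of_mem V hV U hU y hy (h ▸ haU))
  refine ⟨?_, hya⟩
  by_contra hcon
  have hyk : k < y := lt_of_le_of_ne (not_lt.1 hcon) fun h =>
    hVU (hP.eq_of_mem V hV U hU y hy (h ▸ hkU))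
  have hax : a < x := by
    rcases Finset.mem_insert.1 (hP.subset V hV hx) with h | h
    · exact absurd h hxa
    · exact ha x h
  exact hVU (hP.noncrossing U hU V hV a haU x hx k hkU y hy hax hxk hyk).symm

theorem IsNCBlocks.restrict_lt {α : Type*} [LinearOrder α] {a k : α} {S : Finset α}
    (ha : ∀ x ∈ S, a < x) {P : Finset (Finset α)}
    (hP : IsNCBlocks (insert a S) P) (hk : IsNextIn a k P) :
    IsNCBlocks (S.filter (· < k)) (P.filter (fun V => V ⊆ S.filter (· < k))) := by
  constructor
  · exact fun V hV => hP.nonempty V (Finset.mem_filter.1 hV).1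
  · exact fun V hV => (Finset.mem_filter.1 hV).2
  · intro x hx
    obtain ⟨hxS, hxk⟩ := Finset.mem_filter.1 hx
    obtain ⟨V, hV, hxV⟩ := hP.cover x (Finset.mem_insert_of_mem hxS)
    refine ⟨V, Finset.mem_filter.2 ⟨hV, fun y hy => ?_⟩, hxV⟩
    have := hP.split ha hk hV hxV hxk (ha x hxS).ne' hy
    exact Finset.mem_filter.2 ⟨(Finset.mem_insert.1 (hP.subset V hV hy)).resolve_left this.2, this.1⟩
  · exact fun V hV W hW => hP.eq_of_mem V (Finset.mem_filter.1 hV).1 W (Finset.mem_filter.1 hW).1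
  · exact fun V hV W hW =>
      hP.noncrossing V (Finset.mem_filter.1 hV).1 W (Finset.mem_filter.1 hW).1

theorem IsNCBlocks.exists_ge {α : Type*} [LinearOrder α] {a k : α} {S : Finset α}
    (ha : ∀ x ∈ S, a < x) (hkS : k ∈ S) {P : Finset (Finset α)}
    (hP : IsNCBlocks (insert a S) P) (hk : IsNextIn a k P) {V : Finset α} (hV : V ∈ P)
    (hVn : ¬ V ⊆ S.filter (· < k)) : V.erase a ⊆ S.filter (k ≤ ·) ∧ (V.erase a).Nonempty := by
  have hmem : ∀ y ∈ V.erase a, y ∈ S := fun y hy =>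
    (Finset.mem_insert.1 (hP.subset V hV (Finset.mem_of_mem_erase hy))).resolve_left
      (Finset.ne_of_mem_erase hy)
  constructor
  · intro y hy
    refine Finset.mem_filter.2 ⟨hmem y hy, not_lt.1 fun hlt => hVn fun z hz => ?_⟩
    have := hP.split ha hk hV (Finset.mem_of_mem_erase hy) hlt (Finset.ne_of_mem_erase hy) hz
    exact Finset.mem_filter.2 ⟨hmem z (Finset.mem_erase.2 ⟨this.2, hz⟩), this.1⟩
  · by_cases haV : a ∈ V
    · obtain ⟨U, hU, haU, hkU, hmin⟩ := hk
      have hUV := hP.eq_of_mem V hV U hU a haV haU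
      subst hUV
      exact ⟨k, Finset.mem_erase.2 ⟨(ha k hkS).ne', hkU⟩⟩
    · rw [Finset.erase_eq_of_notMem haV]
      exact hP.nonempty V hV

theorem IsNCBlocks.restrict_ge {α : Type*} [LinearOrder α] {a k : α} {S : Finset α}
    (ha : ∀ x ∈ S, a < x) (hkS : k ∈ S) {P : Finset (Finset α)}
    (hP : IsNCBlocks (insert a S) P) (hk : IsNextIn a k P) :
    IsNCBlocks (S.filter (k ≤ ·))
      ((P.filter (fun V => ¬ V ⊆ S.filter (· < k))).image (·.erase a)) := by
  constructor
  · intro V hV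
    simp only [Finset.mem_image, Finset.mem_filter] at hV
    obtain ⟨U, ⟨hU, hUn⟩, rfl⟩ := hV
    exact (hP.exists_ge ha hkS hk hU hUn).2
  · intro V hV
    simp only [Finset.mem_image, Finset.mem_filter] at hV
    obtain ⟨U, ⟨hU, hUn⟩, rfl⟩ := hV
    exact (hP.exists_ge ha hkS hk hU hUn).1
  · intro x hx
    obtain ⟨hxS, hxk⟩ := Finset.mem_filter.1 hx
    obtain ⟨V, hV, hxV⟩ := hP.cover x (Finset.mem_insert_of_mem hxS)
    refine ⟨V.erase a, Finset.mem_image_of_mem _ (Finset.mem_filter.2 ⟨hV, fun h => ?_⟩),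
      Finset.mem_erase.2 ⟨(ha x hxS).ne', hxV⟩⟩
    exact absurd (Finset.mem_filter.1 (h hxV)).2 hxk.not_gt
  · intro V hV W hW x hxV hxW
    simp only [Finset.mem_image, Finset.mem_filter] at hV hW
    obtain ⟨V, ⟨hV, -⟩, rfl⟩ := hV
    obtain ⟨W, ⟨hW, -⟩, rfl⟩ := hW
    rw [hP.eq_of_mem V hV W hW x (Finset.mem_of_mem_erase hxV) (Finset.mem_of_mem_erase hxW)]
  · intro V hV W hW x₁ hx₁ x₂ hx₂ y₁ hy₁ y₂ hy₂ h1 h2 h3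
    simp only [Finset.mem_image, Finset.mem_filter] at hV hW
    obtain ⟨V, ⟨hV, -⟩, rfl⟩ := hV
    obtain ⟨W, ⟨hW, -⟩, rfl⟩ := hW
    rw [hP.noncrossing V hV W hW x₁ (Finset.mem_of_mem_erase hx₁) x₂ (Finset.mem_of_mem_erase hx₂)
      y₁ (Finset.mem_of_mem_erase hy₁) y₂ (Finset.mem_of_mem_erase hy₂) h1 h2 h3]

/-- If `k` follows `a` in its block, the elements strictly between them are closed off by the
non-crossing condition. The partition is thus an arbitrary one below `k` together with an arbitrary
one from `k` on, with `a` attached to the block of `k`; the weight of that block records the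
attachment. -/
theorem sum_ncBlocks_isNextIn {α : Type*} [LinearOrder α] {a k : α} {S : Finset α}
    (ha : ∀ x ∈ S, a < x) (hk : k ∈ S) (g f : Finset α → ℂ) [DecidablePred (IsNextIn a k)] :
    ∑ P ∈ (ncBlocks (insert a S)).filter (IsNextIn a k),
      ∏ V ∈ P, (if a ∈ V then g V else f V) =
    ncSum f (S.filter (· < k)) * ncSumAt k (fun V => g (insert a V)) f (S.filter (k ≤ ·)) := by
  have haS : a ∉ S := fun h => lt_irrefl _ (ha a h)
  have ham : ∀ {p : α → Prop} [DecidablePred p] {V : Finset α}, V ⊆ S.filter p → a ∉ V :=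
    fun hV h => haS (Finset.mem_filter.1 (hV h)).1
  have hdisj : ∀ {Q₂ : Finset (Finset α)}, IsNCBlocks (S.filter (k ≤ ·)) Q₂ →
      ∀ V ∈ Q₂.image (joinBlock a k), ¬ V ⊆ S.filter (· < k) := by
    intro Q₂ h₂ V hV hsub
    obtain ⟨U, hU, rfl⟩ := Finset.mem_image.1 hV
    obtain ⟨x, hx⟩ := h₂.nonempty U hU
    exact absurd (Finset.mem_filter.1 (hsub (subset_joinBlock hx))).2
      (Finset.mem_filter.1 (h₂.subset U hU hx)).2.not_gt
  rw [ncSum, ncSumAt, Finset.sum_mul_sum, ← Finset.sum_product']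
  symm
  refine Finset.sum_bij' (fun Q _ => Q.1 ∪ Q.2.image (joinBlock a k))
    (fun P _ => (P.filter (fun V => V ⊆ S.filter (· < k)),
      (P.filter (fun V => ¬ V ⊆ S.filter (· < k))).image (·.erase a))) ?_ ?_ ?_ ?_ ?_
  · rintro ⟨Q₁, Q₂⟩ hQ
    simp only [Finset.mem_product, mem_ncBlocks, Finset.mem_filter] at hQ ⊢
    refine ⟨hQ.1.join ha hk hQ.2, ?_⟩
    obtain ⟨U, hU, hkU⟩ := hQ.2.cover k (by simp [hk])
    refine ⟨_, Finset.mem_union_right _ (Finset.mem_image_of_mem _ hU),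
      mem_joinBlock.2 (Or.inr ⟨rfl, hkU⟩), subset_joinBlock hkU, fun x hx => ?_⟩
    rcases mem_joinBlock.1 hx with h | h
    · exact Or.inr (Finset.mem_filter.1 (hQ.2.subset U hU h)).2
    · exact Or.inl h.1
  · intro P hP
    simp only [Finset.mem_product, mem_ncBlocks, Finset.mem_filter] at hP ⊢
    exact ⟨hP.1.restrict_lt ha hP.2, hP.1.restrict_ge ha hk hP.2⟩
  · rintro ⟨Q₁, Q₂⟩ hQ
    simp only [Finset.mem_product, mem_ncBlocks] at hQ
    have e₁ : Q₁.filter (fun V => V ⊆ S.filter (· < k)) = Q₁ :=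
      Finset.filter_true_of_mem hQ.1.subset
    have e₁' : Q₁.filter (fun V => ¬ V ⊆ S.filter (· < k)) = ∅ :=
      Finset.filter_false_of_mem fun V hV h => h (hQ.1.subset V hV)
    have e₂ : (Q₂.image (joinBlock a k)).filter (fun V => V ⊆ S.filter (· < k)) = ∅ :=
      Finset.filter_false_of_mem (hdisj hQ.2)
    have e₂' : (Q₂.image (joinBlock a k)).filter (fun V => ¬ V ⊆ S.filter (· < k)) =
        Q₂.image (joinBlock a k) := Finset.filter_true_of_mem (hdisj hQ.2)
    simp only [Finset.filter_union, e₁, e₁', e₂, e₂', Finset.union_empty, Finset.empty_union,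
      Finset.image_image]
    congr 1
    have : Q₂.image ((fun x => x.erase a) ∘ joinBlock a k) = Q₂.image id :=
      Finset.image_congr fun U hU => joinBlock_erase (ham (hQ.2.subset U hU))
    rw [this, Finset.image_id]
  · intro P hP
    simp only [mem_ncBlocks, Finset.mem_filter] at hP
    have : ((P.filter (fun V => ¬ V ⊆ S.filter (· < k))).image (·.erase a)).image (joinBlock a k) =
        (P.filter (fun V => ¬ V ⊆ S.filter (· < k))).image id := by
      rw [Finset.image_image]
      refine Finset.image_congr fun V hV => ?_
      obtain ⟨hV, hVn⟩ := Finset.mem_filter.1 hV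
      obtain ⟨U, hU, haU, hkU, hmin⟩ := hP.2
      simp only [Function.comp, joinBlock, id]
      have hka : k ≠ a := (ha k hk).ne'
      by_cases hkV : k ∈ V
      · have := hP.1.eq_of_mem V hV U hU k hkV hkU
        subst this
        rw [if_pos (Finset.mem_erase.2 ⟨hka, hkV⟩), Finset.insert_erase haU]
      · rw [if_neg fun h => hkV (Finset.mem_of_mem_erase h)]
        refine Finset.erase_eq_of_notMem fun haV => hkV ?_
        rw [hP.1.eq_of_mem V hV U hU a haV haU]
        exact hkU
    simp only [this, Finset.image_id]
    exact Finset.filter_union_filter_not_eq _ _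
  · rintro ⟨Q₁, Q₂⟩ hQ
    simp only [Finset.mem_product, mem_ncBlocks] at hQ
    rw [Finset.prod_union, Finset.prod_image]
    · congr 1
      · refine Finset.prod_congr rfl fun V hV => ?_
        rw [if_neg (ham (hQ.1.subset V hV))]
      · refine Finset.prod_congr rfl fun V hV => ?_
        have haV := ham (hQ.2.subset V hV)
        unfold joinBlock
        split_ifs with h1 h2
        · rfl
        · exact absurd (Finset.mem_insert_self _ _) ‹_›
        · rfl
    · intro V hV W hW h
      rw [← joinBlock_erase (k := k) (ham (hQ.2.subset V hV)), h,
        joinBlock_erase (ham (hQ.2.subset W hW))]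
    · exact Finset.disjoint_left.2 fun V hV hV' => hdisj hQ.2 V hV' (hQ.1.subset V hV)

/-- The decomposition of non-crossing partitions according to the second element of the block
of the minimum. -/
theorem ncSumAt_insert {α : Type*} [LinearOrder α] {a : α} {S : Finset α}
    (ha : ∀ x ∈ S, a < x) (g f : Finset α → ℂ) :
    ncSumAt a g f (insert a S) = g {a} * ncSum f S +
      ∑ k ∈ S, ncSum f (S.filter (· < k)) *
        ncSumAt k (fun V => g (insert a V)) f (S.filter (k ≤ ·)) := by
  classical
  have haS : a ∉ S := fun h => lt_irrefl _ (ha a h)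
  rw [← sum_ncBlocks_singleton_mem haS g f,
    ← Finset.sum_congr rfl fun k hk => sum_ncBlocks_isNextIn ha hk g f, ncSumAt,
    ← Finset.sum_filter_add_sum_filter_not (ncBlocks (insert a S)) (fun P => {a} ∈ P)]
  congr 1
  rw [← Finset.sum_biUnion]
  · refine Finset.sum_congr ?_ fun _ _ => rfl
    ext P
    simp only [Finset.mem_filter, Finset.mem_biUnion, mem_ncBlocks]
    constructor
    · rintro ⟨hP, hs⟩
      obtain ⟨V, hV, haV⟩ := hP.cover a (Finset.mem_insert_self _ _)
      have hne : (V.erase a).Nonempty := by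
        rw [Finset.nonempty_iff_ne_empty]
        intro h
        rcases (Finset.erase_eq_empty_iff _ _).1 h with h | h
        · simp [h] at haV
        · exact hs (h ▸ hV)
      have hm := Finset.min'_mem _ hne
      refine ⟨(V.erase a).min' hne, ?_, hP, V, hV, haV, Finset.mem_of_mem_erase hm, fun x hx => ?_⟩
      · exact (Finset.mem_insert.1 (hP.subset V hV (Finset.mem_of_mem_erase hm))).resolve_left
          (Finset.ne_of_mem_erase hm)
      · by_cases hxa : x = a
        · exact Or.inl hxa
        · exact Or.inr (Finset.min'_le _ _ (Finset.mem_erase.2 ⟨hxa, hx⟩))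
    · rintro ⟨k, hk, hP, V, hV, haV, hkV, -⟩
      refine ⟨hP, fun hs => ?_⟩
      have := hP.eq_of_mem V hV _ hs a haV (by simp)
      subst this
      exact (ha k hk).ne' (Finset.mem_singleton.1 hkV)
  · intro k hk l hl hkl
    refine Finset.disjoint_left.2 fun P hP hP' => hkl ?_
    simp only [Finset.mem_filter, mem_ncBlocks] at hP hP'
    obtain ⟨hP, V, hV, haV, hkV, hmin⟩ := hP
    obtain ⟨-, W, hW, haW, hlW, hmin'⟩ := hP'
    have := hP.eq_of_mem V hV W hW a haV haW
    subst this
    exact le_antisymm ((hmin l hlW).resolve_left (ha l hl).ne')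
      ((hmin' k hkV).resolve_left (ha k hk).ne')

end NonCrossing

/-! ### Transport to intervals of natural numbers, and the recursions there -/

section NonCrossingTransport

theorem IsNCBlocks.map {α γ : Type*} [LinearOrder α] [LinearOrder γ] (e : α ↪o γ)
    {S : Finset α} {P : Finset (Finset α)} (hP : IsNCBlocks S P) :
    IsNCBlocks (S.map e.toEmbedding) (P.image (Finset.map e.toEmbedding)) := by
  constructor
  · intro V hV
    obtain ⟨U, hU, rfl⟩ := Finset.mem_image.1 hV
    exact (hP.nonempty U hU).map
  · intro V hV
    obtain ⟨U, hU, rfl⟩ := Finset.mem_image.1 hV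
    exact Finset.map_subset_map.2 (hP.subset U hU)
  · intro x hx
    obtain ⟨y, hy, rfl⟩ := Finset.mem_map.1 hx
    obtain ⟨V, hV, h⟩ := hP.cover y hy
    exact ⟨_, Finset.mem_image_of_mem _ hV, Finset.mem_map_of_mem _ h⟩
  · intro V hV W hW x hxV hxW
    obtain ⟨V, hV', rfl⟩ := Finset.mem_image.1 hV
    obtain ⟨W, hW', rfl⟩ := Finset.mem_image.1 hW
    obtain ⟨y, hy, rfl⟩ := Finset.mem_map.1 hxV
    rw [hP.eq_of_mem V hV' W hW' y hy ((Finset.mem_map' _).1 hxW)]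
  · intro V hV W hW x₁ hx₁ x₂ hx₂ y₁ hy₁ y₂ hy₂ h1 h2 h3
    obtain ⟨V, hV', rfl⟩ := Finset.mem_image.1 hV
    obtain ⟨W, hW', rfl⟩ := Finset.mem_image.1 hW
    obtain ⟨x₁, hx₁', rfl⟩ := Finset.mem_map.1 hx₁
    obtain ⟨x₂, hx₂', rfl⟩ := Finset.mem_map.1 hx₂
    obtain ⟨y₁, hy₁', rfl⟩ := Finset.mem_map.1 hy₁
    obtain ⟨y₂, hy₂', rfl⟩ := Finset.mem_map.1 hy₂
    rw [hP.noncrossing V hV' W hW' x₁ hx₁' x₂ hx₂' y₁ hy₁' y₂ hy₂' (e.lt_iff_lt.1 h1) (e.lt_iff_lt.1 h2)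
      (e.lt_iff_lt.1 h3)]

theorem IsNCBlocks.comap {α γ : Type*} [LinearOrder α] [LinearOrder γ] (e : α ↪o γ)
    {S : Finset α} {P : Finset (Finset γ)} (hP : IsNCBlocks (S.map e.toEmbedding) P) :
    IsNCBlocks S (P.image (fun V => S.filter (fun x => e x ∈ V))) := by
  constructor
  · intro V hV
    obtain ⟨U, hU, rfl⟩ := Finset.mem_image.1 hV
    obtain ⟨x, hx⟩ := hP.nonempty U hU
    obtain ⟨y, hy, rfl⟩ := Finset.mem_map.1 (hP.subset U hU hx)
    exact ⟨y, Finset.mem_filter.2 ⟨hy, hx⟩⟩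
  · intro V hV
    obtain ⟨U, hU, rfl⟩ := Finset.mem_image.1 hV
    exact Finset.filter_subset _ _
  · intro x hx
    obtain ⟨V, hV, h⟩ := hP.cover (e x) (Finset.mem_map_of_mem e.toEmbedding hx)
    exact ⟨_, Finset.mem_image_of_mem _ hV, Finset.mem_filter.2 ⟨hx, h⟩⟩
  · intro V hV W hW x hxV hxW
    obtain ⟨V, hV', rfl⟩ := Finset.mem_image.1 hV
    obtain ⟨W, hW', rfl⟩ := Finset.mem_image.1 hW
    rw [hP.eq_of_mem V hV' W hW' (e x) (Finset.mem_filter.1 hxV).2 (Finset.mem_filter.1 hxW).2]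
  · intro V hV W hW x₁ hx₁ x₂ hx₂ y₁ hy₁ y₂ hy₂ h1 h2 h3
    obtain ⟨V, hV', rfl⟩ := Finset.mem_image.1 hV
    obtain ⟨W, hW', rfl⟩ := Finset.mem_image.1 hW
    rw [hP.noncrossing V hV' W hW' _ (Finset.mem_filter.1 hx₁).2 _ (Finset.mem_filter.1 hx₂).2
      _ (Finset.mem_filter.1 hy₁).2 _ (Finset.mem_filter.1 hy₂).2 (e.lt_iff_lt.2 h1)
      (e.lt_iff_lt.2 h2) (e.lt_iff_lt.2 h3)]

theorem ncSum_map {α γ : Type*} [LinearOrder α] [LinearOrder γ] (e : α ↪o γ)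
    (f : Finset γ → ℂ) (S : Finset α) :
    ncSum f (S.map e.toEmbedding) = ncSum (fun V => f (V.map e.toEmbedding)) S := by
  symm
  refine Finset.sum_bij' (fun P _ => P.image (Finset.map e.toEmbedding))
    (fun P _ => P.image (fun V => S.filter (fun x => e x ∈ V))) ?_ ?_ ?_ ?_ ?_
  · exact fun P hP => mem_ncBlocks.2 ((mem_ncBlocks.1 hP).map e)
  · exact fun P hP => mem_ncBlocks.2 ((mem_ncBlocks.1 hP).comap e)
  · intro P hP
    rw [mem_ncBlocks] at hP
    simp only [Finset.image_image]
    refine (Finset.image_congr fun V hV => ?_).trans Finset.image_id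
    ext x
    have : e x ∈ V.map e.toEmbedding ↔ x ∈ V := Finset.mem_map' e.toEmbedding
    simp only [Function.comp, Finset.mem_filter, this, id]
    exact ⟨fun h => h.2, fun h => ⟨hP.subset V hV h, h⟩⟩
  · intro P hP
    rw [mem_ncBlocks] at hP
    simp only [Finset.image_image]
    refine (Finset.image_congr fun V hV => ?_).trans Finset.image_id
    ext x
    simp only [Function.comp, Finset.mem_map, Finset.mem_filter, id]
    constructor
    · rintro ⟨y, hy, rfl⟩
      exact hy.2
    · intro hx
      obtain ⟨y, hy, rfl⟩ := Finset.mem_map.1 (hP.subset V hV hx)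
      exact ⟨y, ⟨hy, hx⟩, rfl⟩
  · intro P hP
    rw [Finset.prod_image fun V _ W _ h => Finset.map_injective _ h]

theorem sum_NC_eq_ncSum {n : ℕ} (f : Finset (Fin n) → ℂ) :
    ∑ π ∈ NC n, ∏ V ∈ π.parts, f V = ncSum f Finset.univ := by
  classical
  refine Finset.sum_bij (fun π _ => π.parts) ?_ ?_ ?_ ?_
  · intro π hπ
    simp only [NC, Finset.mem_filter, Finset.mem_univ, true_and] at hπ
    refine mem_ncBlocks.2 ⟨fun V hV => π.nonempty_of_mem_parts hV, fun V _ => Finset.subset_univ V,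
      fun x _ => π.exists_mem (Finset.mem_univ x),
      fun V hV W hW x hxV hxW => π.eq_of_mem_parts hV hW hxV hxW, ?_⟩
    intro V hV W hW x₁ hx₁ x₂ hx₂ y₁ hy₁ y₂ hy₂ h1 h2 h3
    by_contra hne
    exact hπ V hV W hW hne ⟨x₁, hx₁, x₂, hx₂, y₁, hy₁, y₂, hy₂, h1, h2, h3⟩
  · exact fun π _ π' _ h => Finpartition.ext h
  · intro P hP
    rw [mem_ncBlocks] at hP
    have hsup : P.sup id = (Finset.univ : Finset (Fin n)) := by
      refine Finset.eq_univ_iff_forall.2 fun x => ?_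
      obtain ⟨V, hV, h⟩ := hP.cover x (Finset.mem_univ x)
      exact Finset.mem_sup.2 ⟨V, hV, h⟩
    have hdis : (P : Set (Finset (Fin n))).PairwiseDisjoint id := by
      intro V hV W hW hne
      exact Finset.disjoint_left.2 fun x hx hx' => hne (hP.eq_of_mem V hV W hW x hx hx')
    refine ⟨⟨P, Finset.supIndep_iff_pairwiseDisjoint.2 hdis, hsup, fun h => ?_⟩, ?_, rfl⟩
    · exact (hP.nonempty _ h).ne_empty rfl
    · simp only [NC, Finset.mem_filter, Finset.mem_univ, true_and]
      rintro V hV W hW hne ⟨x₁, hx₁, x₂, hx₂, y₁, hy₁, y₂, hy₂, h1, h2, h3⟩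
      exact hne (hP.noncrossing V hV W hW x₁ hx₁ x₂ hx₂ y₁ hy₁ y₂ hy₂ h1 h2 h3)
  · exact fun _ _ => rfl

/-- The order embedding `i ↦ m + i` of `Fin n` into `ℕ`. -/
def finShift (m n : ℕ) : Fin n ↪o ℕ :=
  OrderEmbedding.ofStrictMono (fun i => m + i) fun i j h => by
    have : (i : ℕ) < j := h
    simpa using this

theorem finShift_apply (m n : ℕ) (i : Fin n) : finShift m n i = m + i := rfl

theorem map_finShift_univ (m n : ℕ) :
    (Finset.univ : Finset (Fin n)).map (finShift m n).toEmbedding = Finset.Ico m (m + n) := by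
  ext x
  simp only [Finset.mem_map, Finset.mem_univ, true_and, Finset.mem_Ico,
    RelEmbedding.coe_toEmbedding, finShift_apply]
  constructor
  · rintro ⟨i, rfl⟩
    omega
  · rintro ⟨h1, h2⟩
    exact ⟨⟨x - m, by omega⟩, by simp only []; omega⟩

theorem ncSumAt_Ico {m n : ℕ} (h : m < n) (g f : Finset ℕ → ℂ) :
    ncSumAt m g f (Finset.Ico m n) = g {m} * ncSum f (Finset.Ico (m + 1) n) +
      ∑ k ∈ Finset.Ico (m + 1) n, ncSum f (Finset.Ico (m + 1) k) *
        ncSumAt k (fun V => g (insert m V)) f (Finset.Ico k n) := by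
  have h1 : Finset.Ico m n = insert m (Finset.Ico (m + 1) n) := by
    ext x; simp only [Finset.mem_Ico, Finset.mem_insert]; omega
  rw [h1, ncSumAt_insert fun x hx => by rw [Finset.mem_Ico] at hx; omega]
  refine congrArg₂ (· + ·) rfl (Finset.sum_congr rfl fun k hk => ?_)
  rw [Finset.mem_Ico] at hk
  have h2 : (Finset.Ico (m + 1) n).filter (· < k) = Finset.Ico (m + 1) k := by
    ext x; simp only [Finset.mem_Ico, Finset.mem_filter]; omega
  have h3 : (Finset.Ico (m + 1) n).filter (k ≤ ·) = Finset.Ico k n := by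
    ext x; simp only [Finset.mem_Ico, Finset.mem_filter]; omega
  rw [h2, h3]

/-- If blocks with a number of elements other than two have weight zero, then the sum over
non-crossing partitions satisfies the recursion of the sum over non-crossing pairings. -/
theorem ncSum_Ico_of_pairing {f : Finset ℕ → ℂ} {m n : ℕ} (h : m < n)
    (hf : ∀ V : Finset ℕ, V.Nonempty → V.card ≠ 2 → f V = 0) :
    ncSum f (Finset.Ico m n) = ∑ k ∈ Finset.Ico (m + 1) n, f {m, k} *
      ncSum f (Finset.Ico (m + 1) k) * ncSum f (Finset.Ico (k + 1) n) := by
  rw [← ncSumAt_self m, ncSumAt_Ico h, hf {m} (by simp) (by simp), zero_mul, zero_add]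
  refine Finset.sum_congr rfl fun k hk => ?_
  rw [Finset.mem_Ico] at hk
  -- The block of `m` contains `k`. A third element `l` would make its weight vanish, so only the
  -- block `{m, k}` survives.
  rw [ncSumAt_Ico hk.2, Finset.sum_eq_zero, add_zero]
  · ring
  · intro l hl
    rw [Finset.mem_Ico] at hl
    rw [ncSumAt_eq_zero, mul_zero]
    · simp [hl.2]
    · intro V hV hlV
      refine hf _ (by simp) fun hc => ?_
      have : ({m, k, l} : Finset ℕ) ⊆ insert m (insert k V) := by
        intro x hx
        simp only [Finset.mem_insert, Finset.mem_singleton] at hx ⊢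
        rcases hx with rfl | rfl | rfl <;> simp [hlV]
      have := Finset.card_le_card this
      rw [hc, Finset.card_eq_three.2 ⟨m, k, l, by omega, by omega, by omega, rfl⟩] at this
      omega

/-- A sequence satisfying the recursion of the sums over non-crossing partitions whose blocks
are weighted by their sizes is given by these sums. -/
theorem ncSum_Ico_card {κ M : ℕ → ℂ} {t : ℕ → ℕ → ℂ} (h0 : M 0 = 1)
    (hM : ∀ n, M (n + 1) = κ 1 * M n + ∑ k ∈ Finset.range n, M k * t 1 (n - 1 - k))
    (ht : ∀ r, 1 ≤ r → ∀ n, t r n =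
      κ (r + 1) * M n + ∑ k ∈ Finset.range n, M k * t (r + 1) (n - 1 - k)) (n : ℕ) :
    (∀ m, ncSum (fun V : Finset ℕ => κ V.card) (Finset.Ico m (m + n)) = M n) ∧
    ∀ r, 1 ≤ r → ∀ m, ncSumAt m (fun V : Finset ℕ => κ (r + V.card)) (fun V => κ V.card)
      (Finset.Ico m (m + (n + 1))) = t r n := by
  induction n using Nat.strong_induction_on with
  | _ n ih =>
    -- `r` counts the elements already removed from the block of the current minimum. With `k`
    -- elements between the minimum and its successor in the block, the interval from the successor
    -- on has `n' - k = (n' - 1 - k) + 1` elements, whence the index `n' - 1 - k`.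
    have step : ∀ r n', (∀ l < n', ∀ m, ncSumAt m (fun V : Finset ℕ => κ (r + 1 + V.card))
          (fun V => κ V.card) (Finset.Ico m (m + (l + 1))) = t (r + 1) l) →
        (∀ l ≤ n', ∀ m, ncSum (fun V : Finset ℕ => κ V.card) (Finset.Ico m (m + l)) = M l) →
        ∀ m, ncSumAt m (fun V : Finset ℕ => κ (r + V.card)) (fun V => κ V.card)
          (Finset.Ico m (m + (n' + 1))) =
        κ (r + 1) * M n' + ∑ k ∈ Finset.range n', M k * t (r + 1) (n' - 1 - k) := by
      intro r n' h1 h2 m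
      rw [ncSumAt_Ico (by omega), Finset.card_singleton,
        show m + (n' + 1) = m + 1 + n' by ring, h2 n' le_rfl, Finset.sum_Ico_eq_sum_range,
        show m + 1 + n' - (m + 1) = n' by omega]
      congr 1
      refine Finset.sum_congr rfl fun k hk => ?_
      rw [Finset.mem_range] at hk
      rw [h2 k hk.le, ← h1 (n' - 1 - k) (by omega) (m + 1 + k),
        show m + 1 + k + (n' - 1 - k + 1) = m + 1 + n' by omega]
      congr 1
      refine ncSumAt_congr (fun V hV _ => ?_) fun _ _ _ => rfl
      rw [Finset.card_insert_of_notMem fun h => by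
        have := Finset.mem_Ico.1 (hV h); omega]
      congr 1
      ring
    have hMn : ∀ m, ncSum (fun V : Finset ℕ => κ V.card) (Finset.Ico m (m + n)) = M n := by
      intro m
      cases n with
      | zero => simp [ncSum_empty, h0]
      | succ n =>
        -- The moment recursion is the case `r = 0`: no element of the block has been removed yet.
        rw [hM, ← ncSumAt_self m]
        have := step 0 n (fun l hl m => by simpa using (ih l (by omega)).2 1 le_rfl m)
          (fun l hl m => (ih l (by omega)).1 m) m
        simpa using this
    refine ⟨hMn, fun r hr m => ?_⟩
    rw [ht r hr, step r n (fun l hl m => (ih l hl).2 (r + 1) (by omega) m)]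
    intro l hl m
    rcases hl.eq_or_lt with rfl | hl
    · exact hMn m
    · exact (ih l hl).1 m

end NonCrossingTransport

/-! ### Moments of words as sums over non-crossing partitions -/

section Words

variable {A : Type*} [CStarAlgebra A]

/-- The free cumulant of the variables `a i`, `i ∈ V`. -/
noncomputable def blockCumulant (φ : A →L[ℂ] ℂ) (a : ℕ → A) (V : Finset ℕ) : ℂ :=
  freeCumulant φ V.card (fun i => a (V.orderEmbOfFin rfl i))

theorem blockCumulant_map_finShift (φ : A →L[ℂ] ℂ) (a : ℕ → A) (m n : ℕ) (V : Finset (Fin n)) :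
    blockCumulant φ a (V.map (finShift m n).toEmbedding) =
      freeCumulant φ V.card (fun i => a (m + (V.orderEmbOfFin rfl i : ℕ))) := by
  have aux : ∀ (W : Finset ℕ) (k : ℕ) (h : W.card = k),
      blockCumulant φ a W = freeCumulant φ k (fun i => a (W.orderEmbOfFin h i)) := by
    intro W k h
    subst h
    rfl
  have hc : (V.map (finShift m n).toEmbedding).card = V.card := Finset.card_map _
  rw [aux _ V.card hc]
  congr 1
  funext i
  have := Finset.orderEmbOfFin_unique hc
    (f := fun i => finShift m n (V.orderEmbOfFin rfl i))
    (fun i => Finset.mem_map_of_mem _ (Finset.orderEmbOfFin_mem V rfl i))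
    ((finShift m n).strictMono.comp (V.orderEmbOfFin rfl).strictMono)
  rw [← this]
  rfl

/-- The product `a m * a (m + 1) * ⋯ * a (m + n - 1)`. -/
def wordProd (a : ℕ → A) (m n : ℕ) : A := ((List.range' m n).map a).prod

theorem wordProd_succ (a : ℕ → A) (m n : ℕ) :
    wordProd a m (n + 1) = a m * wordProd a (m + 1) n := by
  simp [wordProd, List.range'_succ]

theorem apply_wordProd (φ : A →L[ℂ] ℂ) (h1 : φ 1 = 1) (a : ℕ → A) (m n : ℕ) :
    φ (wordProd a m n) = ncSum (blockCumulant φ a) (Finset.Ico m (m + n)) := by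
  rcases Nat.eq_zero_or_pos n with rfl | hn
  · simp [wordProd, ncSum_empty, h1]
  · have : wordProd a m n = (List.ofFn fun i : Fin n => a (m + i)).prod := by
      rw [wordProd]
      congr 1
      refine List.ext_getElem (by simp) fun i h1 h2 => by simp
    rw [this, moment_eq_sum_freeCumulant φ hn, sum_NC_eq_ncSum
      (fun V => freeCumulant φ V.card (fun i => a (m + (V.orderEmbOfFin rfl i : ℕ)))),
      ← map_finShift_univ, ncSum_map]
    simp only [blockCumulant_map_finShift]

/-- Only pairings contribute. The partner `k` of the first letter separates the rest of the word
into the letters under the arc and those after it, which are paired independently. -/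
theorem apply_wordProd_of_semicircular {φ : A →L[ℂ] ℂ} (h1 : φ 1 = 1) {I : Set ℝ} {X : ℝ → A}
    (hX : IsSemicircularProcess φ I X) {t : ℕ → ℝ} (ht : ∀ i, t i ∈ I) (m n : ℕ) :
    φ (wordProd (fun i => X (t i)) m (n + 1)) =
      ∑ k ∈ Finset.Ico (m + 1) (m + 1 + n), φ (X (t m) * X (t k)) *
        φ (wordProd (fun i => X (t i)) (m + 1) (k - (m + 1))) *
        φ (wordProd (fun i => X (t i)) (k + 1) (m + 1 + n - (k + 1))) := by
  rw [apply_wordProd φ h1, ncSum_Ico_of_pairing (by omega)]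
  · refine Finset.sum_congr (by congr 1; ring) fun k hk => ?_
    rw [Finset.mem_Ico] at hk
    rw [apply_wordProd φ h1, apply_wordProd φ h1, show m + 1 + (k - (m + 1)) = k by omega,
      show k + 1 + (m + 1 + n - (k + 1)) = m + (n + 1) by omega]
    congr 2
    have hc : ({m, k} : Finset ℕ).card = 2 := Finset.card_pair (by omega)
    have key : blockCumulant φ (fun i => X (t i)) {m, k} =
        freeCumulant φ 2 (fun i => X (t (({m, k} : Finset ℕ).orderEmbOfFin hc i))) := by
      unfold blockCumulant
      generalize hV : ({m, k} : Finset ℕ) = V at hc ⊢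
      have aux : ∀ (j : ℕ) (h : V.card = j),
          freeCumulant φ V.card (fun i => X (t (V.orderEmbOfFin rfl i))) =
          freeCumulant φ j (fun i => X (t (V.orderEmbOfFin h i))) := by
        rintro _ rfl; rfl
      exact aux 2 hc
    have h2 : ![m, k] = ⇑(({m, k} : Finset ℕ).orderEmbOfFin hc) := by
      refine Finset.orderEmbOfFin_unique hc (fun i => ?_) ?_
      · fin_cases i <;> simp
      · intro i j hij
        fin_cases i <;> fin_cases j <;> simp at hij ⊢
        omega
    rw [key, ← h2]
    refine Eq.trans ?_ ((hX 2 ![t m, t k] (by intro p; fin_cases p <;> simp [ht])).cumulant_two 0 1)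
    congr 1
    funext i
    fin_cases i <;> rfl
  · intro V hV hc
    exact (hX V.card (fun i => t (V.orderEmbOfFin rfl i)) fun _ => ht _).cumulant_ne_two V.card
      (Finset.card_pos.2 hV) hc id

end Words

/-! ### Schwinger-Dyson equations for semicircular words -/

section Contraction

variable {A : Type*} [CStarAlgebra A]

theorem apply_wordProd_odd {φ : A →L[ℂ] ℂ} (h1 : φ 1 = 1) {I : Set ℝ} {X : ℝ → A}
    (hX : IsSemicircularProcess φ I X) {t : ℕ → ℝ} (ht : ∀ i, t i ∈ I) {n : ℕ} (hn : Odd n)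
    (m : ℕ) : φ (wordProd (fun i => X (t i)) m n) = 0 := by
  induction n using Nat.strong_induction_on generalizing m with
  | _ n ih =>
    obtain _ | n := n
    · simp at hn
    rw [apply_wordProd_of_semicircular h1 hX ht]
    refine Finset.sum_eq_zero fun k hk => ?_
    rw [Finset.mem_Ico] at hk
    -- Two letters are used up by the pair, so the remaining two words have odd total length and one
    -- of them is odd.
    rcases Nat.even_or_odd (k - (m + 1)) with h | h
    · rw [ih (m + 1 + n - (k + 1)) (by omega) (by grind), mul_zero]
    · rw [ih (k - (m + 1)) (by omega) h, mul_zero, zero_mul]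

theorem prod_map_eq_wordProd (X : ℝ → A) (t₀ : ℝ) (ts : List ℝ) :
    (ts.map X).prod = wordProd (fun i => X (ts.getD i t₀)) 0 ts.length := by
  rw [wordProd]
  congr 1
  refine List.ext_getElem (by simp) fun i h1 h2 => ?_
  simp at h1
  simp [h1]

theorem getD_mem {I : Set ℝ} {t₀ : ℝ} (h₀ : t₀ ∈ I) {ts : List ℝ} (h : ∀ t ∈ ts, t ∈ I) (i : ℕ) :
    ts.getD i t₀ ∈ I := by
  rcases lt_or_ge i ts.length with hi | hi
  · rw [List.getD_eq_getElem _ _ hi]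
    exact h _ (List.getElem_mem hi)
  · rw [List.getD_eq_default _ _ hi]
    exact h₀

theorem apply_prod_map_odd {φ : A →L[ℂ] ℂ} (h1 : φ 1 = 1) {I : Set ℝ} {X : ℝ → A}
    (hX : IsSemicircularProcess φ I X) {ts : List ℝ} (ht : ∀ t ∈ ts, t ∈ I)
    (hn : Odd ts.length) : φ (ts.map X).prod = 0 := by
  obtain _ | ⟨t₀, ts⟩ := ts
  · simp at hn
  · rw [prod_map_eq_wordProd X t₀]
    exact apply_wordProd_odd h1 hX (fun i => getD_mem (ht t₀ (by simp)) ht i) hn 0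

/-- A letter of a word in elements of `A` and a distinguished element. -/
inductive Letter (A : Type*) where
  | lin (v : A)
  | sq

/-- The value of a letter; the distinguished element is `G`. -/
def Letter.val (G : A) : Letter A → A
  | .lin v => v
  | .sq => G

/-- The value of a word. -/
def lettersProd (G : A) (L : List (Letter A)) : A := (L.map (Letter.val G)).prod

@[simp]
theorem lettersProd_nil (G : A) : lettersProd G [] = 1 := rfl

@[simp]
theorem lettersProd_lin (G v : A) (L : List (Letter A)) :
    lettersProd G (.lin v :: L) = v * lettersProd G L := by
  simp [lettersProd, Letter.val]

@[simp]
theorem lettersProd_sq (G : A) (L : List (Letter A)) :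
    lettersProd G (.sq :: L) = G * lettersProd G L := by
  simp [lettersProd, Letter.val]

theorem lettersProd_append (G : A) (L L' : List (Letter A)) :
    lettersProd G (L ++ L') = lettersProd G L * lettersProd G L' := by
  simp [lettersProd]

theorem lettersProd_map_lin (G : A) (L : List A) :
    lettersProd G (L.map .lin) = L.prod := by
  induction L with
  | nil => rfl
  | cons v L ih => rw [List.map_cons, lettersProd_lin, ih, List.prod_cons]

/-- Right multiplication as a continuous linear map. -/
noncomputable def mulRightL (v : A) : A →L[ℂ] A := (ContinuousLinearMap.mul ℂ A).flip v

@[simp]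
theorem mulRightL_apply (v w : A) : mulRightL v w = w * v := rfl

/-- Left multiplication as a continuous linear map. -/
noncomputable def mulLeftL (v : A) : A →L[ℂ] A := ContinuousLinearMap.mul ℂ A v

@[simp]
theorem mulLeftL_apply (v w : A) : mulLeftL v w = v * w := rfl

/-- The sum over all contractions of `x` with a letter of the word `P L`, as a functional of the
prefix `P`, which is itself not contracted. Contracting `x` with `v` gives the scalar `φ (x v)`
and splits the word there. Contracting `x` with the distinguished element `G` puts `y` on either
side of the cut. -/
noncomputable def contract (φ : A →L[ℂ] ℂ) (G x y : A) : List (Letter A) → (A →L[ℂ] ℂ)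
  | [] => 0
  | .lin v :: L => (φ (x * v) * φ (lettersProd G L)) • φ + (contract φ G x y L).comp (mulRightL v)
  | .sq :: L => φ (y * lettersProd G L) • φ + φ (lettersProd G L) • φ.comp (mulRightL y) +
      (contract φ G x y L).comp (mulRightL G)

theorem contract_lin (φ : A →L[ℂ] ℂ) (G x y v P : A) (L : List (Letter A)) :
    contract φ G x y (.lin v :: L) P =
      φ (x * v) * φ P * φ (lettersProd G L) + contract φ G x y L (P * v) := by
  simp [contract]; ring

theorem contract_sq (φ : A →L[ℂ] ℂ) (G x y P : A) (L : List (Letter A)) :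
    contract φ G x y (.sq :: L) P = φ P * φ (y * lettersProd G L) +
      φ (P * y) * φ (lettersProd G L) + contract φ G x y L (P * G) := by
  simp [contract]; ring

theorem contract_range' (φ : A →L[ℂ] ℂ) (G x y : A) (a : ℕ → A) (P : A) (k n : ℕ) :
    contract φ G x y (((List.range' k n).map a).map .lin) P =
      ∑ j ∈ Finset.Ico k (k + n), φ (x * a j) * φ (P * wordProd a k (j - k)) *
        φ (wordProd a (j + 1) (k + n - (j + 1))) := by
  induction n generalizing k P with
  | zero => simp [contract]
  | succ n ih =>
    rw [List.range'_succ, List.map_cons, List.map_cons, contract_lin, ih,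
      Finset.sum_eq_sum_Ico_succ_bot (show k < k + (n + 1) by omega), lettersProd_map_lin]
    congr 1
    · simp [wordProd, show k + (n + 1) - (k + 1) = n by omega]
    · refine Finset.sum_congr (by congr 1; ring) fun j hj => ?_
      rw [Finset.mem_Ico] at hj
      rw [show k + 1 + n - (j + 1) = k + (n + 1) - (j + 1) by omega,
        show j - k = j - (k + 1) + 1 by omega, wordProd_succ, mul_assoc P]

/-- The Schwinger-Dyson equation for words in a semicircular process. -/
theorem apply_mul_prod_map {φ : A →L[ℂ] ℂ} (h1 : φ 1 = 1) {I : Set ℝ} {X : ℝ → A}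
    (hX : IsSemicircularProcess φ I X) (G y : A) {s : ℝ} (hs : s ∈ I) {ts : List ℝ}
    (ht : ∀ t ∈ ts, t ∈ I) :
    φ (X s * (ts.map X).prod) = contract φ G (X s) y ((ts.map X).map .lin) 1 := by
  -- The recursion asks for times in `I` at every index. The default value `s` provides them past
  -- the end of the word.
  have hmem : ∀ i, (s :: ts).getD i s ∈ I := getD_mem hs (by simpa [hs] using ht)
  have e : ts.map X = (List.range' 1 ts.length).map (fun i => X ((s :: ts).getD i s)) := by
    refine List.ext_getElem (by simp) fun i h1 h2 => ?_
    simp at h1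
    simp [add_comm 1 i, h1]
  have e2 : X s * (ts.map X).prod = wordProd (fun i => X ((s :: ts).getD i s)) 0
      (ts.length + 1) := by
    rw [wordProd_succ, e]
    rfl
  rw [e2, apply_wordProd_of_semicircular h1 hX hmem, e, contract_range']
  simp

theorem contract_append_lin_add (φ : A →L[ℂ] ℂ) (G x y P u v : A) (L L' : List (Letter A)) :
    contract φ G x y (L ++ .lin (u + v) :: L') P =
      contract φ G x y (L ++ .lin u :: L') P + contract φ G x y (L ++ .lin v :: L') P := by
  induction L generalizing P with
  | nil => simp only [List.nil_append, contract_lin, mul_add, map_add]; ring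
  | cons l L ih =>
    cases l <;> simp only [List.cons_append, contract_lin, contract_sq, ih, lettersProd_append,
      lettersProd_lin, add_mul, mul_add, map_add] <;> ring

theorem contract_append_lin_smul (φ : A →L[ℂ] ℂ) (G x y P v : A) (c : ℂ)
    (L L' : List (Letter A)) :
    contract φ G x y (L ++ .lin (c • v) :: L') P = c * contract φ G x y (L ++ .lin v :: L') P := by
  induction L generalizing P with
  | nil =>
    simp only [List.nil_append, contract_lin, mul_smul_comm, map_smul, smul_eq_mul]; ring
  | cons l L ih =>
    cases l <;> simp only [List.cons_append, contract_lin, contract_sq, ih, lettersProd_append,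
      lettersProd_lin, smul_mul_assoc, mul_smul_comm, map_smul, smul_eq_mul] <;> ring

/-- Additivity in `x` with `y` held fixed is available because the word has only linear letters; a
letter `.sq` would contribute terms in `y` that do not involve `x`. -/
theorem contract_add (φ : A →L[ℂ] ℂ) (G x x' y P : A) (L : List A) :
    contract φ G (x + x') y (L.map .lin) P =
      contract φ G x y (L.map .lin) P + contract φ G x' y (L.map .lin) P := by
  induction L generalizing P with
  | nil => simp [contract]
  | cons v L ih => simp only [List.map_cons, contract_lin, ih, add_mul, map_add]; ring

theorem contract_smul (φ : A →L[ℂ] ℂ) (G x y P : A) (c : ℂ) (L : List A) :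
    contract φ G (c • x) y (L.map .lin) P = c * contract φ G x y (L.map .lin) P := by
  induction L generalizing P with
  | nil => simp [contract]
  | cons v L ih =>
    simp only [List.map_cons, contract_lin, ih, smul_mul_assoc, map_smul, smul_eq_mul]; ring

/-- The Schwinger-Dyson equation for words in linear combinations of the variables of a
semicircular process. -/
theorem apply_mul_prod_of_mem_span {φ : A →L[ℂ] ℂ} (h1 : φ 1 = 1) {I : Set ℝ} {X : ℝ → A}
    (hX : IsSemicircularProcess φ I X) (G y : A) {x : A} (hx : x ∈ Submodule.span ℂ (X '' I))
    {L : List A} (hL : ∀ v ∈ L, v ∈ Submodule.span ℂ (X '' I)) :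
    φ (x * L.prod) = contract φ G x y (L.map .lin) 1 := by
  -- Letters are treated from the left. Both sides are linear in the next letter, so it may be taken
  -- to be a variable of the process and moved into the prefix `ts`.
  have main : ∀ s ∈ I, ∀ L : List A, (∀ v ∈ L, v ∈ Submodule.span ℂ (X '' I)) →
      ∀ ts : List ℝ, (∀ t ∈ ts, t ∈ I) → φ (X s * ((ts.map X).prod * L.prod)) =
        contract φ G (X s) y ((ts.map X).map .lin ++ L.map .lin) 1 := by
    intro s hs L
    induction L with
    | nil =>
      intro _ ts hts
      simpa using apply_mul_prod_map h1 hX G y hs hts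
    | cons v L ih =>
      intro hL ts hts
      have hL' : ∀ v ∈ L, v ∈ Submodule.span ℂ (X '' I) := fun v hv => hL v (by simp [hv])
      rw [List.map_cons, List.prod_cons]
      have hv := hL v (by simp)
      clear hL
      induction hv using Submodule.span_induction with
      | mem v hv =>
        obtain ⟨t, ht, rfl⟩ := hv
        have := ih hL' (ts ++ [t]) (by
          intro r hr
          rcases List.mem_append.1 hr with hr | hr
          · exact hts r hr
          · rw [List.mem_singleton.1 hr]; exact ht)
        simpa [mul_assoc] using this
      | zero =>
        have := contract_append_lin_smul φ G (X s) y 1 0 0 ((ts.map X).map .lin) (L.map .lin)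
        rw [zero_smul, zero_mul] at this
        rw [this]
        simp
      | add u v _ _ hu hv =>
        rw [contract_append_lin_add, ← hu, ← hv]
        simp only [add_mul, mul_add, map_add]
      | smul c v _ hv =>
        rw [contract_append_lin_smul, ← hv]
        simp only [smul_mul_assoc, mul_smul_comm, map_smul, smul_eq_mul]
  induction hx using Submodule.span_induction with
  | mem x hx =>
    obtain ⟨s, hs, rfl⟩ := hx
    simpa using main s hs L hL [] (by simp)
  | zero =>
    have := contract_smul φ G 0 y 1 0 L
    rw [zero_smul, zero_mul] at this
    rw [this]
    simp
  | add u v _ _ hu hv => rw [contract_add, ← hu, ← hv, add_mul, map_add]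
  | smul c v _ hv => rw [contract_smul, ← hv, smul_mul_assoc, map_smul, smul_eq_mul]

theorem contract_replicate_lin (φ : A →L[ℂ] ℂ) (G x y v P : A) (n : ℕ) :
    contract φ G x y ((List.replicate n v).map .lin) P =
      ∑ k ∈ Finset.range n, φ (x * v) * φ (P * v ^ k) * φ (v ^ (n - 1 - k)) := by
  induction n generalizing P with
  | zero => simp [contract]
  | succ n ih =>
    rw [List.replicate_succ, List.map_cons, contract_lin, ih, Finset.sum_range_succ',
      lettersProd_map_lin, add_comm, List.prod_replicate]
    congr 1
    · refine Finset.sum_congr rfl fun k _ => ?_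
      rw [pow_succ' v k, mul_assoc P, show n + 1 - 1 - (k + 1) = n - 1 - k by omega]
    · simp

theorem contract_replicate_sq (φ : A →L[ℂ] ℂ) (G x y P : A) (n : ℕ) (L : List (Letter A)) :
    contract φ G x y (List.replicate n .sq ++ L) P =
      ∑ k ∈ Finset.range n, (φ (P * G ^ k) * φ (y * (G ^ (n - 1 - k) * lettersProd G L)) +
        φ (P * G ^ k * y) * φ (G ^ (n - 1 - k) * lettersProd G L)) +
      contract φ G x y L (P * G ^ n) := by
  have hrep : ∀ n, lettersProd G (List.replicate n .sq ++ L) = G ^ n * lettersProd G L := by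
    intro n
    induction n with
    | zero => simp
    | succ n ih =>
      rw [List.replicate_succ, List.cons_append, lettersProd_sq, ih, pow_succ', mul_assoc]
  induction n generalizing P with
  | zero => simp
  | succ n ih =>
    rw [List.replicate_succ, List.cons_append, contract_sq, ih, hrep, Finset.sum_range_succ',
      pow_succ' G n, mul_assoc P]
    have : ∀ k, n + 1 - 1 - (k + 1) = n - 1 - k := by omega
    simp only [this, pow_succ' G, mul_assoc]
    simp only [pow_zero, mul_one, one_mul, Nat.add_sub_cancel, Nat.sub_zero]
    ring

end Contraction

/-! ### Catalan moments of increments and norm continuity -/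

section NormContinuity

variable {A : Type*} [CStarAlgebra A]

theorem sum_range_two_mul_add_one_of_odd {F : ℕ → ℂ} (hF : ∀ k, F (2 * k + 1) = 0) (n : ℕ) :
    ∑ k ∈ Finset.range (2 * n + 1), F k = ∑ k ∈ Finset.range (n + 1), F (2 * k) := by
  induction n with
  | zero => simp
  | succ n ih =>
    rw [show 2 * (n + 1) + 1 = 2 * n + 1 + 1 + 1 by ring, Finset.sum_range_succ,
      Finset.sum_range_succ, ih, Finset.sum_range_succ _ (n + 1), hF, add_zero]
    rfl

/-- The moments of a semicircular element. -/
theorem apply_pow_of_mem_span {φ : A →L[ℂ] ℂ} (h1 : φ 1 = 1) {I : Set ℝ} {X : ℝ → A}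
    (hX : IsSemicircularProcess φ I X) {a : A} (ha : a ∈ Submodule.span ℂ (X '' I)) (n : ℕ) :
    φ (a ^ (2 * n + 1)) = 0 ∧ φ (a ^ (2 * n)) = φ (a * a) ^ n * catalan n := by
  have hrec : ∀ n, φ (a ^ (n + 1)) =
      ∑ k ∈ Finset.range n, φ (a * a) * φ (a ^ k) * φ (a ^ (n - 1 - k)) := by
    intro n
    -- `G` and `y` enter only through letters `.sq`, of which there are none here, so `0` serves for
    -- both.
    have := apply_mul_prod_of_mem_span h1 hX 0 0 ha (L := List.replicate n a)
      (fun v hv => by rwa [List.eq_of_mem_replicate hv])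
    rwa [contract_replicate_lin, List.prod_replicate, ← pow_succ',
      Finset.sum_congr rfl fun k _ => by rw [one_mul]] at this
  have hodd : ∀ n, Odd n → φ (a ^ n) = 0 := by
    intro n
    induction n using Nat.strong_induction_on with
    | _ n ih =>
      intro hn
      obtain _ | n := n
      · simp at hn
      rw [hrec]
      refine Finset.sum_eq_zero fun k hk => ?_
      rw [Finset.mem_range] at hk
      rcases Nat.even_or_odd k with h | h
      · rw [ih (n - 1 - k) (by omega) (by grind), mul_zero]
      · rw [ih k (by omega) h, mul_zero, zero_mul]
  refine ⟨hodd _ (by simp), ?_⟩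
  induction n using Nat.strong_induction_on with
  | _ n ih =>
    obtain _ | n := n
    · simp [h1]
    rw [show 2 * (n + 1) = 2 * n + 1 + 1 by ring, hrec, sum_range_two_mul_add_one_of_odd
      (fun k => by rw [hodd (2 * k + 1) (by simp)]; ring), catalan_succ, Nat.cast_sum,
      Finset.mul_sum, Finset.sum_range (n := n + 1)]
    refine Finset.sum_congr rfl fun k _ => ?_
    have hk := k.2
    have e : φ (a * a) ^ (n + 1) = φ (a * a) * φ (a * a) ^ (k : ℕ) * φ (a * a) ^ (n - k) := by
      rw [← pow_succ', ← pow_add]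
      congr 1
      omega
    rw [ih k hk, show 2 * n + 1 - 1 - 2 * (k : ℕ) = 2 * (n - k) by omega, ih (n - k) (by omega), e]
    push_cast
    ring

theorem catalan_le_four_pow (n : ℕ) : catalan n ≤ 4 ^ n := by
  rw [catalan_eq_centralBinom_div]
  refine (Nat.div_le_self _ _).trans ?_
  rw [Nat.centralBinom_eq_two_mul_choose]
  refine (Nat.choose_le_two_pow _ _).trans ?_
  rw [pow_mul]
  norm_num

/-- `g` is the square of `√g`, and `cfc` of the latter is self-adjoint. For `a` not self-adjoint,
`cfc` takes the default value `0`. -/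
theorem IsState.re_apply_cfc_nonneg {φ : A →L[ℂ] ℂ} (hφ : IsState φ) {a : A} {g : ℝ → ℝ}
    (hg : Continuous g) (hg0 : ∀ x, 0 ≤ g x) : 0 ≤ (φ (cfc g a)).re := by
  have h : cfc g a = star (cfc (fun x => √(g x)) a) * cfc (fun x => √(g x)) a := by
    rw [(cfc_predicate (fun x => √(g x)) a).star_eq, ← cfc_mul _ _ a
      (Continuous.continuousOn (by fun_prop)) (Continuous.continuousOn (by fun_prop))]
    congr 1
    funext x
    exact (Real.mul_self_sqrt (hg0 x)).symm
  rw [h]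
  exact (Complex.le_def.1 (hφ.nonneg _)).1

/-- For a faithful state, the norm of a self-adjoint element is bounded by the growth rate of
its even moments. -/
theorem IsState.norm_le_of_moments {φ : A →L[ℂ] ℂ} (hφ : IsState φ)
    (hf : IsFaithfulFunctional φ) {a : A} (ha : IsSelfAdjoint a) {C : ℝ} (hC : 0 ≤ C)
    (h : ∀ n : ℕ, ‖φ (a ^ (2 * n))‖ ≤ C ^ (2 * n)) : ‖a‖ ≤ C := by
  refine le_of_forall_gt_imp_ge_of_dense fun c hc => ?_
  have hc0 : 0 < c := hC.trans_lt hc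
  -- `f` vanishes exactly on `[-c, c]`, and `c ^ (2 n) f² ≤ x ^ (2 n + 2)` everywhere. The moments
  -- then force `φ (f(a)²) = 0`, hence `f(a) = 0` by faithfulness, so the spectrum lies in `[-c,
  -- c]`.
  set f : ℝ → ℝ := fun x => max (|x| - c) 0 with hfdef
  have hfc : Continuous f := by fun_prop
  have hbound : ∀ n : ℕ, c ^ (2 * n) * (φ (cfc f a * cfc f a)).re ≤ C ^ (2 * (n + 1)) := by
    intro n
    have h1 : cfc (fun x => x ^ (2 * (n + 1)) - c ^ (2 * n) * (f x * f x)) a =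
        a ^ (2 * (n + 1)) - c ^ (2 * n) • (cfc f a * cfc f a) := by
      rw [cfc_sub (fun x => x ^ (2 * (n + 1))) (fun x => c ^ (2 * n) * (f x * f x)) a
        (Continuous.continuousOn (by fun_prop)) (Continuous.continuousOn (by fun_prop)),
        cfc_const_mul _ _ a (Continuous.continuousOn (by fun_prop)),
        cfc_mul _ _ a hfc.continuousOn hfc.continuousOn, cfc_pow_id a _ ha]
    have h2 := hφ.re_apply_cfc_nonneg (a := a)
      (g := fun x => x ^ (2 * (n + 1)) - c ^ (2 * n) * (f x * f x)) (by fun_prop) (by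
        intro x
        rw [sub_nonneg]
        rcases le_total (|x| - c) 0 with hx | hx
        · simp only [hfdef, max_eq_right hx, mul_zero]
          rw [pow_mul]
          positivity
        · have e1 : f x = |x| - c := max_eq_left hx
          have e2 : x ^ (2 * (n + 1)) = |x| ^ (2 * n) * (|x| * |x|) := by
            rw [pow_mul, ← sq_abs, ← pow_mul]
            ring
          rw [e1, e2]
          have : c ≤ |x| := by linarith
          gcongr <;> linarith)
    rw [h1, map_sub, Complex.sub_re] at h2
    have h3 : φ (c ^ (2 * n) • (cfc f a * cfc f a)) =
        ((c ^ (2 * n) : ℝ) : ℂ) * φ (cfc f a * cfc f a) := by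
      rw [← Complex.coe_smul, map_smul, smul_eq_mul]
    rw [h3, Complex.re_ofReal_mul] at h2
    linarith [(Complex.re_le_norm _).trans (h (n + 1))]
  have hsa : star (cfc f a) = cfc f a := (cfc_predicate f a).star_eq
  have hpos := hφ.nonneg (cfc f a)
  rw [hsa] at hpos
  -- `hbound` gives the upper bound `C² (C / c) ^ (2 n)`, which tends to `0` because `C < c`.
  have hre : (φ (cfc f a * cfc f a)).re ≤ 0 := by
    have hq : C / c < 1 := (div_lt_one hc0).2 hc
    have hq0 : 0 ≤ C / c := by positivity
    have hlim : Filter.Tendsto (fun n : ℕ => C ^ 2 * ((C / c) ^ 2) ^ n) Filter.atTop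
        (nhds (C ^ 2 * 0)) :=
      (tendsto_pow_atTop_nhds_zero_of_lt_one (by positivity) (by nlinarith)).const_mul _
    rw [mul_zero] at hlim
    refine ge_of_tendsto' hlim fun n => ?_
    have h4 := hbound n
    rw [mul_comm, ← le_div_iff₀ (by positivity)] at h4
    refine h4.trans (le_of_eq ?_)
    rw [← pow_mul, div_pow]
    field_simp
    ring
  have hzero : cfc f a = 0 := by
    refine hf _ ?_
    rw [hsa]
    obtain ⟨h5, h6⟩ := Complex.le_def.1 hpos
    exact Complex.ext (le_antisymm hre h5) h6.symm
  have hspec : ∀ x ∈ spectrum ℝ a, |x| ≤ c := by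
    intro x hx
    have h7 : f x ∈ spectrum ℝ (cfc f a) := by
      rw [cfc_map_spectrum f a ha hfc.continuousOn]
      exact ⟨x, hx, rfl⟩
    rw [hzero] at h7
    -- In the zero algebra the spectrum is empty, which contradicts `h7`; otherwise the spectrum of
    -- `0` is `{0}`.
    have : Nontrivial A := by
      by_contra hn
      rw [not_nontrivial_iff_subsingleton] at hn
      rw [spectrum.of_subsingleton] at h7
      exact h7
    rw [spectrum.zero_eq, Set.mem_singleton_iff] at h7
    have := le_max_left (|x| - c) 0
    rw [show max (|x| - c) 0 = f x from rfl, h7] at this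
    linarith
  have := norm_cfc_le (f := fun x : ℝ => x) (a := a) hc0.le fun x hx => hspec x hx
  rwa [cfc_id' ℝ a ha] at this

theorem IsFreeBrownianBridge.apply_sub_mul_sub {φ : A →L[ℂ] ℂ} {β : ℝ → A}
    (hβ : IsFreeBrownianBridge φ 1 β) {s t : ℝ} (hs : s ∈ Set.Icc (0 : ℝ) 1)
    (ht : t ∈ Set.Icc (0 : ℝ) 1) :
    φ ((β t - β s) * (β t - β s)) = ((|t - s| - (t - s) ^ 2 : ℝ) : ℂ) := by
  rw [show (β t - β s) * (β t - β s) = β t * β t - β t * β s - β s * β t + β s * β s by noncomm_ring,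
    map_add, map_sub, map_sub, hβ.covariance t ht t ht, hβ.covariance t ht s hs,
    hβ.covariance s hs t ht, hβ.covariance s hs s hs]
  norm_cast
  rcases le_total s t with h | h
  · rw [min_self, min_self, min_eq_right h, min_eq_left h, abs_of_nonneg (by linarith)]
    ring
  · rw [min_self, min_self, min_eq_left h, min_eq_right h, abs_of_nonpos (by linarith)]
    ring

/-- For a faithful state, a free Brownian bridge is norm continuous. -/
theorem IsFreeBrownianBridge.continuousOn {φ : A →L[ℂ] ℂ} (hφ : IsState φ) {β : ℝ → A}
    (hβ : IsFreeBrownianBridge φ 1 β) (hf : IsFaithfulFunctional φ) :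
    ContinuousOn β (Set.Icc 0 1) := by
  have key : ∀ s ∈ Set.Icc (0 : ℝ) 1, ∀ t ∈ Set.Icc (0 : ℝ) 1,
      ‖β t - β s‖ ≤ 2 * √|t - s| := by
    intro s hs t ht
    have hsa : ∀ r ∈ Set.Icc (0 : ℝ) 1, IsSelfAdjoint (β r) := fun r hr =>
      (hβ.semicircular 1 (fun _ => r) fun _ => hr).selfAdjoint 0
    have hspan : β t - β s ∈ Submodule.span ℂ (β '' Set.Icc (0 : ℝ) 1) :=
      Submodule.sub_mem _ (Submodule.subset_span ⟨t, ht, rfl⟩) (Submodule.subset_span ⟨s, hs, rfl⟩)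
    -- The increment has variance at most `|t - s|`, and the Catalan numbers are at most `4 ^ n`, so
    -- the `2 n`-th moment is at most `(2 √|t - s|) ^ (2 n)`.
    refine hφ.norm_le_of_moments hf ((hsa t ht).sub (hsa s hs)) (by positivity) fun n => ?_
    have hts : |t - s| ≤ 1 := abs_sub_le_iff.2 ⟨by linarith [ht.2, hs.1], by linarith [hs.2, ht.1]⟩
    have h0 : 0 ≤ |t - s| - (t - s) ^ 2 := by
      rw [← sq_abs]
      nlinarith [abs_nonneg (t - s)]
    rw [(apply_pow_of_mem_span hφ.map_one hβ.semicircular hspan n).2, hβ.apply_sub_mul_sub hs ht,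
      norm_mul, norm_pow, Complex.norm_real, Real.norm_of_nonneg h0, Complex.norm_natCast]
    have h2 : (catalan n : ℝ) ≤ 4 ^ n := by exact_mod_cast catalan_le_four_pow n
    calc (|t - s| - (t - s) ^ 2) ^ n * (catalan n : ℝ) ≤ |t - s| ^ n * 4 ^ n := by
          gcongr
          linarith [sq_nonneg (t - s)]
      _ = (2 * √|t - s|) ^ (2 * n) := by
          rw [pow_mul, mul_pow, Real.sq_sqrt (abs_nonneg _), mul_pow]
          norm_num [mul_comm]
  intro s hs
  rw [ContinuousWithinAt, tendsto_iff_norm_sub_tendsto_zero]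
  refine squeeze_zero' (Filter.Eventually.of_forall fun _ => norm_nonneg _)
    (Filter.eventually_of_mem self_mem_nhdsWithin fun t ht => key s hs t ht) ?_
  have : Continuous fun t : ℝ => 2 * √|t - s| := by fun_prop
  simpa using (this.tendsto s).mono_left nhdsWithin_le_nhds

end NormContinuity

/-! ### Power sums of the eigenvalues: zeta values, Bernoulli numbers, cotangent -/

section ZetaCot

/-- `∑ j, (π (j + 1))⁻²ᵐ`. -/
noncomputable def spectralSum (m : ℕ) : ℝ := ∑' j : ℕ, (1 / (Real.pi * (j + 1)) ^ 2) ^ m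

theorem summable_spectralSum {m : ℕ} (hm : 1 ≤ m) :
    Summable fun j : ℕ => (1 / (Real.pi * (j + 1)) ^ 2) ^ m := by
  have h : Summable fun j : ℕ => (1 / Real.pi ^ (2 * m)) * (1 / ((j + 1 : ℕ) : ℝ) ^ (2 * m)) :=
    ((summable_nat_add_iff 1).2 (Real.summable_one_div_nat_pow.2 (by omega))).mul_left _
  refine h.congr fun j => ?_
  push_cast
  rw [one_div_pow, ← pow_mul, mul_pow]
  field_simp

theorem ofReal_spectralSum {m : ℕ} (hm : 1 ≤ m) :
    (spectralSum m : ℂ) = riemannZeta (2 * (m : ℂ)) / (Real.pi : ℂ) ^ (2 * m) := by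
  have h := zeta_nat_eq_tsum_of_gt_one (k := 2 * m) (by omega)
  push_cast at h
  have h2 : Summable fun n : ℕ => 1 / (n : ℂ) ^ (2 * m) := by
    have := Complex.ofRealCLM.summable
      (Real.summable_one_div_nat_pow.2 (show 1 < 2 * m by omega))
    refine this.congr fun n => ?_
    simp
  -- The zeta series is indexed from `0`, where its term is `1 / 0 = 0`; dropping it matches the
  -- index `j + 1`.
  rw [h, h2.tsum_eq_zero_add, spectralSum, Complex.ofReal_tsum, Nat.cast_zero,
    zero_pow (by omega), div_zero, zero_add, ← tsum_div_const]
  refine tsum_congr fun j => ?_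
  push_cast
  rw [one_div_pow, ← pow_mul, mul_pow]
  field_simp

theorem zeta_div_pi_pow_eq_bernoulli {m : ℕ} (hm : 1 ≤ m) :
    riemannZeta (2 * (m : ℂ)) / (Real.pi : ℂ) ^ (2 * m) =
      -(1 / 2) * (-4) ^ m * (bernoulli (2 * m) : ℂ) / ((2 * m).factorial : ℂ) := by
  rw [riemannZeta_two_mul_nat (by omega)]
  have hpi : (Real.pi : ℂ) ≠ 0 := by exact_mod_cast Real.pi_ne_zero
  obtain ⟨k, rfl⟩ : ∃ k, m = k + 1 := ⟨m - 1, by omega⟩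
  have h2 : (2 : ℂ) ^ (2 * (k + 1) - 1) = 2 * 4 ^ k := by
    rw [show 2 * (k + 1) - 1 = 2 * k + 1 by omega, pow_succ, pow_mul]
    norm_num [mul_comm]
  have h4 : (-4 : ℂ) ^ (k + 1) = (-1) ^ (k + 1) * 4 ^ k * 4 := by
    rw [show (-4 : ℂ) = (-1) * 4 by norm_num, mul_pow, pow_succ 4]
    ring
  rw [h2, h4]
  field_simp
  ring

/-- The power series of `(1 - √z cot √z) / (2 z)`. -/
theorem hasSum_spectralSum_mul_pow {z w : ℂ} (hz0 : 0 < ‖z‖) (hz : ‖z‖ < Real.pi ^ 2)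
    (hw : w ^ 2 = z) :
    HasSum (fun n : ℕ => (spectralSum (n + 1) : ℂ) * z ^ n) ((1 - w * Complex.cot w) / (2 * z)) := by
  have hpi : (Real.pi : ℂ) ≠ 0 := by exact_mod_cast Real.pi_ne_zero
  have hpi0 := Real.pi_pos
  have hz' : z ≠ 0 := norm_pos_iff.1 hz0
  have hw0 : w ≠ 0 := by rintro rfl; simp at hw; exact hz' hw.symm
  have hwn : ‖w‖ < Real.pi := by
    have : ‖w‖ ^ 2 < Real.pi ^ 2 := by rw [← norm_pow, hw]; exact hz
    exact lt_of_pow_lt_pow_left₀ 2 hpi0.le this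
  set l : ℕ → ℝ := fun j => 1 / (Real.pi * (j + 1)) ^ 2 with hl
  have hl0 : ∀ j, 0 < l j := fun j => by simp only [hl]; positivity
  have hl1 : ∀ j, l j ≤ 1 / Real.pi ^ 2 := fun j => by
    simp only [hl]
    have : (0 : ℝ) ≤ j := Nat.cast_nonneg j
    have h : Real.pi ≤ Real.pi * (j + 1) := by nlinarith
    gcongr
  have hlz : ∀ j, ‖(l j : ℂ) * z‖ ≤ ‖z‖ / Real.pi ^ 2 := fun j => by
    rw [norm_mul, Complex.norm_real, Real.norm_of_nonneg (hl0 j).le, div_eq_mul_one_div, mul_comm]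
    gcongr
    exact hl1 j
  have hq : ‖z‖ / Real.pi ^ 2 < 1 := (div_lt_one (by positivity)).2 hz
  -- The double series converges absolutely. Summing over `n` first gives the partial fractions `∑ l
  -- j / (1 - l j z)`; summing over `j` first gives the power series with coefficients `spectralSum
  -- (n + 1)`.
  have hsum : Summable fun p : ℕ × ℕ => (l p.1 : ℂ) * ((l p.1 : ℂ) * z) ^ p.2 := by
    have hg : Summable fun p : ℕ × ℕ => l p.1 * (‖z‖ / Real.pi ^ 2) ^ p.2 := by
      refine Summable.mul_of_nonneg (f := l) ?_
        (summable_geometric_of_lt_one (by positivity) hq) (fun j => (hl0 j).le)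
        fun n => by positivity
      simpa [hl] using summable_spectralSum le_rfl
    refine Summable.of_norm_bounded hg fun p => ?_
    rw [norm_mul, norm_pow, Complex.norm_real, Real.norm_of_nonneg (hl0 _).le]
    have := hl0 p.1
    gcongr
    exact hlz p.1
  have hrow : ∀ j : ℕ, HasSum (fun n : ℕ => (l j : ℂ) * ((l j : ℂ) * z) ^ n)
      ((l j : ℂ) * (1 - (l j : ℂ) * z)⁻¹) := fun j =>
    (hasSum_geometric_of_norm_lt_one ((hlz j).trans_lt hq)).mul_left _
  have hcol : ∀ n : ℕ, HasSum (fun j : ℕ => (l j : ℂ) * ((l j : ℂ) * z) ^ n)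
      ((spectralSum (n + 1) : ℂ) * z ^ n) := by
    intro n
    refine ((Complex.hasSum_ofReal.2
      (summable_spectralSum (show 1 ≤ n + 1 by omega)).hasSum).mul_right (z ^ n)).congr_fun ?_
    intro j
    rw [mul_pow, Complex.ofReal_pow, pow_succ]
    ring
  have h1 := hsum.hasSum.prod_fiberwise hrow
  have h2 := (hsum.prod_symm.hasSum).prod_fiberwise hcol
  have h3 : ∑' p : ℕ × ℕ, (l p.swap.1 : ℂ) * ((l p.swap.1 : ℂ) * z) ^ p.swap.2 =
      ∑' p : ℕ × ℕ, (l p.1 : ℂ) * ((l p.1 : ℂ) * z) ^ p.2 :=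
    (Equiv.prodComm ℕ ℕ).tsum_eq fun p : ℕ × ℕ => (l p.1 : ℂ) * ((l p.1 : ℂ) * z) ^ p.2
  -- The partial fraction expansion of the cotangent is used at `w / π`, which is not an integer
  -- since `0 < ‖w‖ < π`.
  have hx : w / Real.pi ∈ Complex.integerComplement := by
    rw [Complex.mem_integerComplement_iff]
    rintro ⟨n, hn⟩
    have hwn' : w = Real.pi * n := by rw [hn]; field_simp
    have h4 : ‖w‖ = Real.pi * |(n : ℝ)| := by
      rw [hwn', norm_mul, Complex.norm_real, Real.norm_of_nonneg hpi0.le, Complex.norm_intCast]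
    rw [h4, mul_lt_iff_lt_one_right hpi0] at hwn
    have h5 : n = 0 := by
      have : |n| < 1 := by exact_mod_cast hwn
      exact Int.abs_lt_one_iff.1 this
    exact hw0 (by rw [hwn', h5]; simp)
  have h6 := cot_series_rep' hx
  have h7 : ∀ j : ℕ, 1 / (w / Real.pi - (j + 1)) + 1 / (w / Real.pi + (j + 1)) =
      (-2 * w * Real.pi) * ((l j : ℂ) * (1 - (l j : ℂ) * z)⁻¹) := by
    intro j
    have e1 : w / Real.pi - (j + 1) ≠ 0 := by
      simpa [sub_eq_add_neg] using
        Complex.integerComplement_add_ne_zero hx (-(j + 1) : ℤ)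
    have e2 : w / Real.pi + (j + 1) ≠ 0 := by
      simpa using Complex.integerComplement_add_ne_zero hx ((j : ℤ) + 1)
    have e3 : ((j : ℂ) + 1) ≠ 0 := Nat.cast_add_one_ne_zero j
    have e4 : w - Real.pi * (j + 1) ≠ 0 := by
      intro h
      apply e1
      rw [sub_eq_zero.1 h]
      field_simp
      ring
    have e5 : w + Real.pi * (j + 1) ≠ 0 := by
      intro h
      apply e2
      rw [eq_neg_of_add_eq_zero_left h]
      field_simp
      ring
    have e6 : (l j : ℂ) * (1 - (l j : ℂ) * z)⁻¹ = 1 / ((Real.pi * (j + 1)) ^ 2 - w ^ 2) := by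
      have e8 : (l j : ℂ) = 1 / (Real.pi * (j + 1)) ^ 2 := by simp [hl]
      have e9 : ((Real.pi * (j + 1)) ^ 2 - w ^ 2 : ℂ) ≠ 0 := by
        rw [sq_sub_sq]
        exact mul_ne_zero (by rwa [add_comm]) fun h => e4 (by rw [← neg_sub, h, neg_zero])
      rw [e8, ← hw]
      field_simp
    have e7 : ((Real.pi * (j + 1)) ^ 2 - w ^ 2 : ℂ) =
        -((w - Real.pi * (j + 1)) * (w + Real.pi * (j + 1))) := by ring
    have e10 : w / Real.pi - (j + 1) = (w - Real.pi * (j + 1)) / Real.pi := by field_simp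
    have e11 : w / Real.pi + (j + 1) = (w + Real.pi * (j + 1)) / Real.pi := by field_simp
    rw [e6, e7, e10, e11]
    field_simp
    ring
  simp only [h7] at h6
  rw [tsum_mul_left, h1.tsum_eq, mul_div_cancel₀ _ hpi] at h6
  convert h2 using 1
  have h8 : ∑' p : ℕ × ℕ, (l p.1 : ℂ) * ((l p.1 : ℂ) * z) ^ p.2 =
      (1 - w * Complex.cot w) / (2 * z) := by
    generalize (∑' p : ℕ × ℕ, (l p.1 : ℂ) * ((l p.1 : ℂ) * z) ^ p.2) = T at h6 ⊢
    rw [← hw]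
    field_simp at h6 ⊢
    linear_combination h6
  exact h8.symm.trans h3.symm

end ZetaCot

/-! ### Spectral decomposition of the Brownian bridge covariance -/

section BridgeKernel

/-- The eigenvalues of the covariance operator of the Brownian bridge. -/
noncomputable def bridgeEigenvalue (j : ℕ) : ℝ := 1 / (Real.pi * (j + 1)) ^ 2

/-- The eigenfunctions of the covariance operator of the Brownian bridge. -/
noncomputable def bridgeEigenfunction (j : ℕ) (t : ℝ) : ℝ := √2 * Real.sin (Real.pi * (j + 1) * t)

/-- The covariance of the Brownian bridge. -/
noncomputable def bridgeKernel (s t : ℝ) : ℝ := min s t - s * t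

theorem bridgeEigenvalue_pos (j : ℕ) : 0 < bridgeEigenvalue j := by
  unfold bridgeEigenvalue
  positivity

theorem summable_bridgeEigenvalue_pow {m : ℕ} (hm : 1 ≤ m) :
    Summable fun j => bridgeEigenvalue j ^ m :=
  summable_spectralSum hm

theorem summable_bridgeEigenvalue : Summable bridgeEigenvalue := by
  simpa using summable_bridgeEigenvalue_pow le_rfl

theorem tsum_bridgeEigenvalue_pow (m : ℕ) :
    ∑' j, bridgeEigenvalue j ^ m = spectralSum m := rfl

@[fun_prop]
theorem continuous_bridgeEigenfunction (j : ℕ) : Continuous (bridgeEigenfunction j) := by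
  unfold bridgeEigenfunction
  fun_prop

theorem continuous_bridgeKernel : Continuous fun p : ℝ × ℝ => bridgeKernel p.1 p.2 := by
  unfold bridgeKernel
  fun_prop

theorem bridgeKernel_comm (s t : ℝ) : bridgeKernel s t = bridgeKernel t s := by
  unfold bridgeKernel
  rw [min_comm, mul_comm]

theorem abs_bridgeEigenfunction_le (j : ℕ) (t : ℝ) : |bridgeEigenfunction j t| ≤ √2 := by
  unfold bridgeEigenfunction
  rw [abs_mul, abs_of_nonneg (Real.sqrt_nonneg 2)]
  exact mul_le_of_le_one_right (Real.sqrt_nonneg 2) (Real.abs_sin_le_one _)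

theorem integral_cos_pi_mul_int {m : ℤ} (hm : m ≠ 0) :
    ∫ t in (0 : ℝ)..1, Real.cos (Real.pi * m * t) = 0 := by
  have h : Real.pi * (m : ℝ) ≠ 0 := mul_ne_zero Real.pi_ne_zero (by exact_mod_cast hm)
  rw [intervalIntegral.integral_comp_mul_left (fun x => Real.cos x) h, integral_cos, mul_zero,
    Real.sin_zero, mul_one, mul_comm Real.pi, Real.sin_int_mul_pi]
  simp

theorem bridgeEigenfunction_mul (j k : ℕ) (s t : ℝ) :
    bridgeEigenfunction j s * bridgeEigenfunction k t =
      Real.cos (Real.pi * (j + 1) * s - Real.pi * (k + 1) * t) -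
        Real.cos (Real.pi * (j + 1) * s + Real.pi * (k + 1) * t) := by
  unfold bridgeEigenfunction
  rw [Real.cos_sub, Real.cos_add]
  have := Real.mul_self_sqrt (show (0 : ℝ) ≤ 2 by norm_num)
  linear_combination Real.sin (Real.pi * (j + 1) * s) * Real.sin (Real.pi * (k + 1) * t) * this

theorem integral_bridgeEigenfunction_mul (j k : ℕ) :
    ∫ t in (0 : ℝ)..1, bridgeEigenfunction j t * bridgeEigenfunction k t =
      if j = k then 1 else 0 := by
  have h : ∀ t, bridgeEigenfunction j t * bridgeEigenfunction k t =
      Real.cos (Real.pi * ((j - k : ℤ) : ℝ) * t) -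
        Real.cos (Real.pi * ((j + k + 2 : ℤ) : ℝ) * t) := by
    intro t
    rw [bridgeEigenfunction_mul]
    push_cast
    congr 2 <;> ring
  simp only [h]
  rw [intervalIntegral.integral_sub (Continuous.intervalIntegrable (by fun_prop) _ _)
    (Continuous.intervalIntegrable (by fun_prop) _ _),
    integral_cos_pi_mul_int (show (j + k + 2 : ℤ) ≠ 0 by omega), sub_zero]
  split_ifs with hjk
  · subst hjk
    simp
  · exact integral_cos_pi_mul_int (by omega)

/-- This is the Fourier series of the Bernoulli polynomial `B₂`, rescaled and reindexed; the dropped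
term at `0` is `1 / 0 = 0`. -/
theorem hasSum_cos_div_sq {x : ℝ} (hx : x ∈ Set.Icc (0 : ℝ) 1) :
    HasSum (fun j : ℕ => bridgeEigenvalue j * Real.cos (2 * Real.pi * (j + 1) * x))
      (x ^ 2 - x + 1 / 6) := by
  have h := hasSum_one_div_nat_pow_mul_cos one_ne_zero hx
  have hB : (Polynomial.map (algebraMap ℚ ℝ) (Polynomial.bernoulli (2 * 1))).eval x =
      x ^ 2 - x + 1 / 6 := by
    simp [Polynomial.bernoulli, Finset.sum_range_succ, Polynomial.eval_add, bernoulli,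
      bernoulli'_two, bernoulli'_one]
    ring
  rw [hB, ← hasSum_nat_add_iff' 1] at h
  have hp := Real.pi_ne_zero
  have h2 := h.mul_left (1 / Real.pi ^ 2)
  have e : x ^ 2 - x + 1 / 6 = 1 / Real.pi ^ 2 *
      ((-1) ^ (1 + 1) * (2 * Real.pi) ^ (2 * 1) / 2 / ((2 * 1).factorial : ℝ) *
        (x ^ 2 - x + 1 / 6) - ∑ i ∈ Finset.range 1,
          1 / (i : ℝ) ^ (2 * 1) * Real.cos (2 * Real.pi * i * x)) := by
    simp
    field_simp
  rw [e]
  refine h2.congr_fun fun j => ?_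
  simp only [bridgeEigenvalue]
  push_cast
  field_simp

/-- The expansion of the covariance of the Brownian bridge in eigenfunctions. -/
theorem hasSum_bridgeKernel {s t : ℝ} (hs : s ∈ Set.Icc (0 : ℝ) 1) (ht : t ∈ Set.Icc (0 : ℝ) 1) :
    HasSum (fun j => bridgeEigenvalue j * bridgeEigenfunction j s * bridgeEigenfunction j t)
      (bridgeKernel s t) := by
  -- The product of two sines is a difference of cosines at `s - t` and `s + t`, so the kernel is a
  -- difference of two values of `B₂`. The absolute value keeps the argument in `[0, 1]`.
  have h1 := hasSum_cos_div_sq (x := |s - t| / 2) ⟨by positivity, by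
    have := abs_sub_le_iff.2 ⟨show s - t ≤ 1 by linarith [hs.2, ht.1],
      show t - s ≤ 1 by linarith [ht.2, hs.1]⟩
    linarith⟩
  have h2 := hasSum_cos_div_sq (x := (s + t) / 2) ⟨by linarith [hs.1, ht.1], by linarith [hs.2, ht.2]⟩
  have hv : bridgeKernel s t = (|s - t| / 2) ^ 2 - |s - t| / 2 + 1 / 6 -
      (((s + t) / 2) ^ 2 - (s + t) / 2 + 1 / 6) := by
    unfold bridgeKernel
    rcases le_total s t with h | h
    · rw [min_eq_left h, abs_of_nonpos (by linarith)]
      ring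
    · rw [min_eq_right h, abs_of_nonneg (by linarith)]
      ring
  rw [hv]
  refine (h1.sub h2).congr_fun fun j => ?_
  have e : Real.cos (2 * Real.pi * (j + 1) * (|s - t| / 2)) =
      Real.cos (Real.pi * (j + 1) * s - Real.pi * (j + 1) * t) := by
    rw [← Real.cos_abs (Real.pi * (j + 1) * s - Real.pi * (j + 1) * t), ← mul_sub, abs_mul,
      abs_of_nonneg (show 0 ≤ Real.pi * ((j : ℝ) + 1) by positivity)]
    congr 1
    ring
  rw [mul_assoc, bridgeEigenfunction_mul, mul_sub, e]
  congr 3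
  ring

/-- Termwise integration of a series dominated by the eigenvalues. -/
theorem hasSum_integral_of_bound {E : Type*} [NormedAddCommGroup E] [NormedSpace ℝ E]
    {F : ℕ → ℝ → E} {f : ℝ → E} {C : ℝ} (hF : ∀ j, Continuous (F j))
    (hb : ∀ j, ∀ t ∈ Set.Icc (0 : ℝ) 1, ‖F j t‖ ≤ bridgeEigenvalue j * C)
    (hf : ∀ t ∈ Set.Icc (0 : ℝ) 1, HasSum (fun j => F j t) (f t)) :
    HasSum (fun j => ∫ t in (0 : ℝ)..1, F j t) (∫ t in (0 : ℝ)..1, f t) := by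
  have hmem : ∀ t ∈ Set.uIoc (0 : ℝ) 1, t ∈ Set.Icc (0 : ℝ) 1 := by
    intro t ht
    rw [Set.uIoc_of_le zero_le_one] at ht
    exact Set.Ioc_subset_Icc_self ht
  refine intervalIntegral.hasSum_integral_of_dominated_convergence
    (fun j _ => bridgeEigenvalue j * C) (fun j => (hF j).aestronglyMeasurable)
    (fun j => Filter.Eventually.of_forall fun t ht => hb j t (hmem t ht))
    (Filter.Eventually.of_forall fun t _ => summable_bridgeEigenvalue.mul_right C)
    intervalIntegrable_const (Filter.Eventually.of_forall fun t ht => hf t (hmem t ht))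

theorem exists_norm_le_of_continuous {E : Type*} [NormedAddCommGroup E] {f : ℝ → E}
    (hf : Continuous f) : ∃ C, ∀ t ∈ Set.Icc (0 : ℝ) 1, ‖f t‖ ≤ C :=
  isCompact_Icc.exists_bound_of_continuousOn hf.continuousOn

theorem hasSum_integral_bridgeKernel_smul {E : Type*} [NormedAddCommGroup E] [NormedSpace ℝ E]
    {f : ℝ → E} (hf : Continuous f) {s : ℝ} (hs : s ∈ Set.Icc (0 : ℝ) 1) :
    HasSum (fun j => (bridgeEigenvalue j * bridgeEigenfunction j s) •
        ∫ t in (0 : ℝ)..1, bridgeEigenfunction j t • f t)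
      (∫ t in (0 : ℝ)..1, bridgeKernel s t • f t) := by
  obtain ⟨C, hC⟩ := exists_norm_le_of_continuous hf
  have h := hasSum_integral_of_bound (C := √2 * √2 * C)
    (F := fun j t => (bridgeEigenvalue j * bridgeEigenfunction j s * bridgeEigenfunction j t) • f t)
    (f := fun t => bridgeKernel s t • f t) (fun j => by fun_prop) (fun j t ht => by
      rw [norm_smul, norm_mul, norm_mul, Real.norm_of_nonneg (bridgeEigenvalue_pos j).le,
        mul_assoc, mul_assoc, mul_assoc]
      have := (bridgeEigenvalue_pos j).le
      gcongr
      · exact abs_bridgeEigenfunction_le j s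
      · exact abs_bridgeEigenfunction_le j t
      · exact hC t ht) fun t ht => (hasSum_bridgeKernel hs ht).smul_const (f t)
  refine h.congr_fun fun j => ?_
  rw [← intervalIntegral.integral_smul]
  simp only [smul_smul]

/-- In the kernel expansion integrated term by term, orthonormality leaves only the term `j`. -/
theorem integral_bridgeKernel_mul_eigenfunction (j : ℕ) {s : ℝ} (hs : s ∈ Set.Icc (0 : ℝ) 1) :
    ∫ t in (0 : ℝ)..1, bridgeKernel s t * bridgeEigenfunction j t =
      bridgeEigenvalue j * bridgeEigenfunction j s := by
  have h := hasSum_integral_bridgeKernel_smul (continuous_bridgeEigenfunction j) hs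
  simp only [smul_eq_mul, integral_bridgeEigenfunction_mul] at h
  refine h.unique ?_
  have h2 := hasSum_ite_eq j (bridgeEigenvalue j * bridgeEigenfunction j s)
  refine h2.congr_fun fun k => ?_
  split_ifs with hk
  · rw [hk, mul_one]
  · rw [mul_zero]

/-- The covariance operator is symmetric: Fubini moves it onto the eigenfunction, where it acts as
multiplication by the eigenvalue. -/
theorem integral_bridgeEigenfunction_smul_integral {E : Type*} [NormedAddCommGroup E]
    [NormedSpace ℝ E] [CompleteSpace E] {f : ℝ → E} (hf : Continuous f) (j : ℕ) :
    ∫ s in (0 : ℝ)..1, bridgeEigenfunction j s • ∫ t in (0 : ℝ)..1, bridgeKernel s t • f t =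
      bridgeEigenvalue j • ∫ t in (0 : ℝ)..1, bridgeEigenfunction j t • f t := by
  have hc : Continuous (Function.uncurry fun s t : ℝ =>
      bridgeEigenfunction j s • bridgeKernel s t • f t) := by
    have := continuous_bridgeKernel
    simp only [Function.uncurry_def]
    fun_prop
  simp only [← intervalIntegral.integral_smul]
  rw [MeasureTheory.intervalIntegral_intervalIntegral_swap]
  · refine intervalIntegral.integral_congr fun t ht => ?_
    rw [Set.uIcc_of_le zero_le_one] at ht
    simp only [smul_smul]
    rw [intervalIntegral.integral_smul_const, ← integral_bridgeKernel_mul_eigenfunction j ht]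
    congr 1
    refine intervalIntegral.integral_congr fun s _ => ?_
    simp only [bridgeKernel_comm s t, mul_comm]
  · refine (hc.continuousOn.integrableOn_compact
      (isCompact_Icc (a := (0 : ℝ)) (b := 1) |>.prod (isCompact_Icc (a := (0 : ℝ)) (b := 1)))).mono_set ?_
    rw [Set.uIoc_of_le zero_le_one]
    exact Set.prod_mono Set.Ioc_subset_Icc_self Set.Ioc_subset_Icc_self

/-- The trace of the covariance operator is the sum of its eigenvalues. -/
theorem integral_bridgeKernel_diag :
    ∫ s in (0 : ℝ)..1, bridgeKernel s s = spectralSum 1 := by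
  have h := hasSum_integral_of_bound (C := √2 * √2)
    (F := fun j t => bridgeEigenvalue j * bridgeEigenfunction j t * bridgeEigenfunction j t)
    (f := fun t => bridgeKernel t t) (fun j => by fun_prop) (fun j t ht => by
      rw [norm_mul, norm_mul, Real.norm_of_nonneg (bridgeEigenvalue_pos j).le, mul_assoc]
      have := (bridgeEigenvalue_pos j).le
      gcongr <;> exact abs_bridgeEigenfunction_le j t) fun t ht => hasSum_bridgeKernel ht ht
  rw [← h.tsum_eq, ← tsum_bridgeEigenvalue_pow]
  refine tsum_congr fun j => ?_
  simp only [mul_assoc]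
  rw [intervalIntegral.integral_const_mul, integral_bridgeEigenfunction_mul, if_pos rfl]
  ring

end BridgeKernel

/-! ### Schwinger-Dyson equations for words containing the square norm -/

section SquareNorm

/-- `h` is continuous, and its integral over `[0, 1]` is `c`. -/
def HasMean (h : ℝ → ℂ) (c : ℂ) : Prop := Continuous h ∧ ∫ t in (0 : ℝ)..1, h t = c

theorem HasMean.add {h h' : ℝ → ℂ} {c c' : ℂ} (H : HasMean h c) (H' : HasMean h' c') :
    HasMean (fun t => h t + h' t) (c + c') :=
  ⟨H.1.add H'.1, by
    rw [intervalIntegral.integral_add (H.1.intervalIntegrable _ _) (H'.1.intervalIntegrable _ _),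
      H.2, H'.2]⟩

theorem HasMean.const_mul {h : ℝ → ℂ} {c : ℂ} (H : HasMean h c) (a : ℂ) :
    HasMean (fun t => a * h t) (a * c) :=
  ⟨H.1.const_mul a, by rw [intervalIntegral.integral_const_mul, H.2]⟩

theorem HasMean.eq_of_eqOn {h h' : ℝ → ℂ} {c c' : ℂ} (H : HasMean h c) (H' : HasMean h' c')
    (e : ∀ t ∈ Set.Icc (0 : ℝ) 1, h t = h' t) : c = c' := by
  rw [← H.2, ← H'.2]
  refine intervalIntegral.integral_congr fun t ht => ?_
  rw [Set.uIcc_of_le zero_le_one] at ht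
  exact e t ht

theorem HasMean.const (c : ℂ) : HasMean (fun _ => c) c :=
  ⟨continuous_const, by simp⟩

theorem HasMean.sum {ι : Type*} (S : Finset ι) {h : ι → ℝ → ℂ} {c : ι → ℂ}
    (H : ∀ i, HasMean (h i) (c i)) : HasMean (fun t => ∑ i ∈ S, h i t) (∑ i ∈ S, c i) := by
  classical
  induction S using Finset.induction_on with
  | empty => simpa using HasMean.const 0
  | insert i S hi ih =>
    simp only [Finset.sum_insert hi]
    exact (H i).add ih

theorem HasMean.ofReal {f : ℝ → ℝ} (hf : Continuous f) :
    HasMean (fun t => (f t : ℂ)) ((∫ t in (0 : ℝ)..1, f t : ℝ) : ℂ) :=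
  ⟨by fun_prop, intervalIntegral.integral_ofReal⟩

variable {A : Type*} [CStarAlgebra A]

theorem HasMean.apply (ψ : A →L[ℂ] ℂ) {F : ℝ → A} (hF : Continuous F) :
    HasMean (fun t => ψ (F t)) (ψ (∫ t in (0 : ℝ)..1, F t)) :=
  ⟨ψ.continuous.comp hF, ψ.intervalIntegral_comp_comm (hF.intervalIntegrable _ _)⟩

/-- A letter `.sq` is the average of two adjacent letters `X t`. Contracting `x` with the first
leaves the second to the right of the cut, and contracting with the second leaves the first to the
left; averaging `φ (x * X t) • X t` gives `y` on that side. These are the two terms in `y` of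
`contract_sq`. -/
theorem hasMean_contract (φ : A →L[ℂ] ℂ) {X : ℝ → A} (hX : Continuous X) (x : A)
    (L L' : List (Letter A)) (P : A) :
    HasMean
      (fun t => contract φ (squareNorm X) x (∫ t in (0 : ℝ)..1, φ (x * X t) • X t)
        (L ++ .lin (X t) :: .lin (X t) :: L') P)
      (contract φ (squareNorm X) x (∫ t in (0 : ℝ)..1, φ (x * X t) • X t)
        (L ++ .sq :: L') P) := by
  set G := squareNorm X with hG
  set y := ∫ t in (0 : ℝ)..1, φ (x * X t) • X t with hy
  have hc : Continuous fun t => φ (x * X t) • X t := by fun_prop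
  have hsq : ∀ ψ : A →L[ℂ] ℂ, HasMean (fun t => ψ (X t * X t)) (ψ G) := by
    intro ψ
    have := HasMean.apply ψ (F := fun t => X t * X t) (hX.mul hX)
    simpa only [pow_two, hG, squareNorm] using this
  induction L generalizing P with
  | nil =>
    simp only [List.nil_append, contract_lin, contract_sq, lettersProd_lin]
    have h1 := (HasMean.apply (φ.comp (mulRightL (lettersProd G L'))) hc).const_mul (φ P)
    have h2 := (HasMean.apply (φ.comp (mulLeftL P)) hc).const_mul (φ (lettersProd G L'))
    have h3 := hsq ((contract φ G x y L').comp (mulLeftL P))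
    convert (h1.add h2).add h3 using 1
    · funext t
      simp [mul_assoc]
      ring
    · simp [hy]
      ring
  | cons l L ih =>
    have hl : ∀ Q : A, HasMean (fun t => φ (Q * lettersProd G (L ++ .lin (X t) :: .lin (X t) :: L')))
        (φ (Q * lettersProd G (L ++ .sq :: L'))) := by
      intro Q
      have := hsq (φ.comp ((mulLeftL (Q * lettersProd G L)).comp (mulRightL (lettersProd G L'))))
      simpa [lettersProd_append, mul_assoc] using this
    have hl' := hl 1
    simp only [one_mul] at hl'
    cases l with
    | lin v =>
      simp only [List.cons_append, contract_lin]
      exact (hl'.const_mul _).add (ih _)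
    | sq =>
      simp only [List.cons_append, contract_sq]
      exact (((hl y).const_mul _).add (hl'.const_mul _)).add (ih _)

/-- The Schwinger-Dyson equation for words in a norm continuous semicircular process and its
square norm. -/
theorem apply_mul_lettersProd {φ : A →L[ℂ] ℂ} (h1 : φ 1 = 1) {X : ℝ → A}
    (hX : IsSemicircularProcess φ (Set.Icc 0 1) X) (hc : Continuous X) {s : ℝ}
    (hs : s ∈ Set.Icc (0 : ℝ) 1) {L : List (Letter A)}
    (hL : ∀ l ∈ L, l = .sq ∨ ∃ t ∈ Set.Icc (0 : ℝ) 1, l = .lin (X t)) :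
    φ (X s * lettersProd (squareNorm X) L) =
      contract φ (squareNorm X) (X s) (∫ t in (0 : ℝ)..1, φ (X s * X t) • X t) L 1 := by
  -- A letter of `L` moves into the prefix `ts`, where `.sq` becomes the pair `[t, t]`. Both sides
  -- of the equation for `.sq` are the averages over `t` of the two sides for that pair.
  have main : ∀ L : List (Letter A),
      (∀ l ∈ L, l = .sq ∨ ∃ t ∈ Set.Icc (0 : ℝ) 1, l = .lin (X t)) →
      ∀ ts : List ℝ, (∀ t ∈ ts, t ∈ Set.Icc (0 : ℝ) 1) →
        φ (X s * lettersProd (squareNorm X) ((ts.map X).map .lin ++ L)) =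
          contract φ (squareNorm X) (X s) (∫ t in (0 : ℝ)..1, φ (X s * X t) • X t)
            ((ts.map X).map .lin ++ L) 1 := by
    intro L
    induction L with
    | nil =>
      intro _ ts hts
      rw [List.append_nil, lettersProd_map_lin]
      exact apply_mul_prod_map h1 hX _ _ hs hts
    | cons l L ih =>
      intro hL ts hts
      have hL' : ∀ l ∈ L, l = .sq ∨ ∃ t ∈ Set.Icc (0 : ℝ) 1, l = .lin (X t) :=
        fun v hv => hL v (by simp [hv])
      rcases hL l (by simp) with rfl | ⟨t, ht, rfl⟩
      · have hm := hasMean_contract φ hc (X s) ((ts.map X).map .lin) L 1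
        have hm' := HasMean.apply (φ.comp ((mulLeftL (X s *
          lettersProd (squareNorm X) ((ts.map X).map .lin))).comp
          (mulRightL (lettersProd (squareNorm X) L)))) (hc.pow 2)
        have := hm'.eq_of_eqOn hm fun t ht => by
          have h2 := ih hL' (ts ++ [t, t]) (by
            intro r hr
            simp only [List.mem_append, List.mem_cons, List.not_mem_nil, or_false, or_self] at hr
            rcases hr with hr | rfl
            · exact hts r hr
            · exact ht)
          simp only [List.map_append, List.map_cons, List.map_nil, List.append_assoc,
            List.cons_append, List.nil_append] at h2
          rw [← h2]
          simp [lettersProd_append, mul_assoc, pow_two]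
        rw [← this]
        simp [lettersProd_append, mul_assoc, squareNorm]
      · have := ih hL' (ts ++ [t]) (by
          intro r hr
          rcases List.mem_append.1 hr with hr | hr
          · exact hts r hr
          · rw [List.mem_singleton.1 hr]; exact ht)
        simpa using this
  simpa using main L hL [] (by simp)

/-- Each factor `squareNorm X` is an average of words of length two, so parity is unchanged and odd
words still have moment `0`. -/
theorem apply_prod_mul_pow_mul_prod_odd {φ : A →L[ℂ] ℂ} (h1 : φ 1 = 1) {X : ℝ → A}
    (hX : IsSemicircularProcess φ (Set.Icc 0 1) X) (hc : Continuous X) (n : ℕ) {us : List ℝ}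
    (hu : ∀ t ∈ us, t ∈ Set.Icc (0 : ℝ) 1) {ts : List ℝ} (ht : ∀ t ∈ ts, t ∈ Set.Icc (0 : ℝ) 1)
    (hodd : Odd (ts.length + us.length)) :
    φ ((ts.map X).prod * squareNorm X ^ n * (us.map X).prod) = 0 := by
  induction n generalizing ts with
  | zero =>
    rw [pow_zero, mul_one, ← List.prod_append, ← List.map_append]
    refine apply_prod_map_odd h1 hX (fun t h => ?_) (by simpa using hodd)
    rcases List.mem_append.1 h with h | h
    · exact ht t h
    · exact hu t h
  | succ n ih =>
    have hm := HasMean.apply (φ.comp ((mulLeftL (ts.map X).prod).comp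
      (mulRightL (squareNorm X ^ n * (us.map X).prod)))) (hc.pow 2)
    have := hm.eq_of_eqOn (HasMean.const 0) fun t h => by
      have h2 := ih (ts := ts ++ [t, t]) (by
        intro r hr
        simp only [List.mem_append, List.mem_cons, List.not_mem_nil, or_false, or_self] at hr
        rcases hr with hr | rfl
        · exact ht r hr
        · exact h) (by
          simp only [List.length_append, List.length_cons, List.length_nil]
          grind)
      rw [← h2]
      simp [mul_assoc, pow_two]
    rw [← this]
    simp [mul_assoc, squareNorm, pow_succ']

end SquareNorm

/-! ### Moment recursion for the square norm of the bridge -/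

section BridgeMoments

variable {A : Type*} [CStarAlgebra A]

theorem IsFreeBrownianBridge.apply_mul {φ : A →L[ℂ] ℂ} {β : ℝ → A}
    (hβ : IsFreeBrownianBridge φ 1 β) {s t : ℝ} (hs : s ∈ Set.Icc (0 : ℝ) 1)
    (ht : t ∈ Set.Icc (0 : ℝ) 1) : φ (β s * β t) = (bridgeKernel s t : ℂ) := by
  rw [hβ.covariance s hs t ht, div_one]
  rfl

/-- The image of `β` under the covariance operator of the Brownian bridge. -/
noncomputable def bridgeConv (β : ℝ → A) (s : ℝ) : A := ∫ t in (0 : ℝ)..1, bridgeKernel s t • β t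

/-- The coordinates of `β` with respect to the eigenfunctions. -/
noncomputable def bridgeCoord (β : ℝ → A) (j : ℕ) : A :=
  ∫ t in (0 : ℝ)..1, bridgeEigenfunction j t • β t

theorem IsFreeBrownianBridge.integral_apply_smul {φ : A →L[ℂ] ℂ} {β : ℝ → A}
    (hβ : IsFreeBrownianBridge φ 1 β) {s : ℝ} (hs : s ∈ Set.Icc (0 : ℝ) 1) :
    ∫ t in (0 : ℝ)..1, φ (β s * β t) • β t = bridgeConv β s := by
  refine intervalIntegral.integral_congr fun t ht => ?_
  rw [Set.uIcc_of_le zero_le_one] at ht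
  simp only [hβ.apply_mul hs ht, Complex.coe_smul]

theorem continuous_bridgeConv {β : ℝ → A} (hc : Continuous β) : Continuous (bridgeConv β) := by
  unfold bridgeConv
  have := continuous_bridgeKernel
  exact intervalIntegral.continuous_parametric_intervalIntegral_of_continuous' (by
    simp only [Function.uncurry_def]; fun_prop) _ _

/-- Contracting `β s` with the last letter gives the first term. Contracting with one of the factors
`Γ` gives two terms, one of which has an odd factor and vanishes. -/
theorem IsFreeBrownianBridge.apply_pow_mul {φ : A →L[ℂ] ℂ} (h1 : φ 1 = 1) {β : ℝ → A}
    (hβ : IsFreeBrownianBridge φ 1 β) (hc : Continuous β) {s u : ℝ} (hs : s ∈ Set.Icc (0 : ℝ) 1)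
    (hu : u ∈ Set.Icc (0 : ℝ) 1) (n : ℕ) :
    φ (β s * (squareNorm β ^ n * β u)) = bridgeKernel s u * φ (squareNorm β ^ n) +
      ∑ k ∈ Finset.range n, φ (squareNorm β ^ k) *
        φ (bridgeConv β s * (squareNorm β ^ (n - 1 - k) * β u)) := by
  have hrep : lettersProd (squareNorm β) (List.replicate n .sq ++ [.lin (β u)]) =
      squareNorm β ^ n * β u := by
    simp [lettersProd, Letter.val]
  rw [← hrep, apply_mul_lettersProd h1 hβ.semicircular hc hs, hβ.integral_apply_smul hs,
    contract_replicate_sq, add_comm]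
  · congr 1
    · rw [contract_lin, hβ.apply_mul hs hu]
      simp [contract, h1]
    · refine Finset.sum_congr rfl fun k _ => ?_
      have := apply_prod_mul_pow_mul_prod_odd h1 hβ.semicircular hc (n - 1 - k) (us := [u])
        (by simpa using hu) (ts := []) (by simp) (by simp)
      simp only [List.map_nil, List.prod_nil, one_mul, List.map_cons, List.prod_cons,
        mul_one] at this
      rw [lettersProd_lin, lettersProd_nil, mul_one, this, mul_zero, add_zero, one_mul]
  · intro l hl
    rcases List.mem_append.1 hl with h | h
    · exact Or.inl (List.eq_of_mem_replicate h)
    · exact Or.inr ⟨u, hu, List.mem_singleton.1 h⟩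

/-- Here the surviving term of a contraction with `Γ` has `bridgeConv β s` to the left of the cut,
next to the uncontracted `β s`; in the other term both factors are odd. -/
theorem IsFreeBrownianBridge.apply_mul_pow {φ : A →L[ℂ] ℂ} (h1 : φ 1 = 1) {β : ℝ → A}
    (hβ : IsFreeBrownianBridge φ 1 β) (hc : Continuous β) {s : ℝ} (hs : s ∈ Set.Icc (0 : ℝ) 1)
    (n : ℕ) :
    φ (β s * (β s * squareNorm β ^ n)) = bridgeKernel s s * φ (squareNorm β ^ n) +
      ∑ k ∈ Finset.range n, φ (squareNorm β ^ (n - 1 - k)) *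
        φ (β s * squareNorm β ^ k * bridgeConv β s) := by
  have hrep : lettersProd (squareNorm β) (.lin (β s) :: (List.replicate n .sq ++ [])) =
      β s * squareNorm β ^ n := by
    simp [lettersProd, Letter.val]
  rw [← hrep, apply_mul_lettersProd h1 hβ.semicircular hc hs, hβ.integral_apply_smul hs,
    contract_lin, contract_replicate_sq]
  · congr 1
    · rw [hβ.apply_mul hs hs]
      simp [lettersProd, Letter.val, h1]
    · rw [contract, zero_apply, add_zero]
      refine Finset.sum_congr rfl fun k _ => ?_
      have := apply_prod_mul_pow_mul_prod_odd h1 hβ.semicircular hc k (us := [])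
        (by simp) (ts := [s]) (by simpa using hs) (by simp)
      simp only [List.map_nil, List.prod_nil, List.map_cons, List.prod_cons, mul_one] at this
      rw [one_mul, this, zero_mul, zero_add, lettersProd_nil, mul_one, mul_comm]
  · intro l hl
    rcases List.mem_cons.1 hl with h | h
    · exact Or.inr ⟨s, hs, h⟩
    · rw [List.append_nil] at h
      exact Or.inl (List.eq_of_mem_replicate h)

/-- The moment `φ (Z Γⁿ Z)` of a coordinate `Z` of `β` and the square norm `Γ`. -/
noncomputable def coordMoment (φ : A →L[ℂ] ℂ) (β : ℝ → A) (j n : ℕ) : ℂ :=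
  φ (bridgeCoord β j * (squareNorm β ^ n * bridgeCoord β j))

theorem HasMean.apply_bridgeCoord (ψ : A →L[ℂ] ℂ) {β : ℝ → A} (hc : Continuous β) (j : ℕ) :
    HasMean (fun t => bridgeEigenfunction j t * ψ (β t)) (ψ (bridgeCoord β j)) := by
  have := HasMean.apply ψ (F := fun t => bridgeEigenfunction j t • β t) (by fun_prop)
  simpa only [← Complex.coe_smul, map_smul, smul_eq_mul, bridgeCoord] using this

theorem HasMean.apply_bridgeConv (ψ : A →L[ℂ] ℂ) {β : ℝ → A} (hc : Continuous β) (j : ℕ) :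
    HasMean (fun s => bridgeEigenfunction j s * ψ (bridgeConv β s))
      (bridgeEigenvalue j * ψ (bridgeCoord β j)) := by
  have hcc := continuous_bridgeConv hc
  have := HasMean.apply ψ (F := fun s => bridgeEigenfunction j s • bridgeConv β s) (by fun_prop)
  simp only [bridgeConv, integral_bridgeEigenfunction_smul_integral hc] at this
  simpa only [← Complex.coe_smul, map_smul, smul_eq_mul, bridgeCoord, bridgeConv] using this

/-- Integrating `apply_pow_mul` against the eigenfunction in `s` turns the covariance operator into
multiplication by the eigenvalue. -/
theorem IsFreeBrownianBridge.apply_bridgeCoord_mul {φ : A →L[ℂ] ℂ} (h1 : φ 1 = 1) {β : ℝ → A}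
    (hβ : IsFreeBrownianBridge φ 1 β) (hc : Continuous β) (j : ℕ) {u : ℝ}
    (hu : u ∈ Set.Icc (0 : ℝ) 1) (n : ℕ) :
    φ (bridgeCoord β j * (squareNorm β ^ n * β u)) =
      φ (squareNorm β ^ n) * (bridgeEigenvalue j * bridgeEigenfunction j u : ℝ) +
      ∑ k ∈ Finset.range n, φ (squareNorm β ^ k) *
        (bridgeEigenvalue j * φ (bridgeCoord β j * (squareNorm β ^ (n - 1 - k) * β u))) := by
  have hL := HasMean.apply_bridgeCoord (φ.comp (mulRightL (squareNorm β ^ n * β u))) hc j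
  have hck := continuous_bridgeKernel
  have hR := ((HasMean.ofReal (f := fun s => bridgeKernel u s * bridgeEigenfunction j s)
      (by fun_prop)).const_mul (φ (squareNorm β ^ n))).add
    (HasMean.sum (Finset.range n) fun k => (HasMean.apply_bridgeConv
      (φ.comp (mulRightL (squareNorm β ^ (n - 1 - k) * β u))) hc j).const_mul
        (φ (squareNorm β ^ k)))
  have := hL.eq_of_eqOn hR fun s hs => by
    simp only [ContinuousLinearMap.comp_apply, mulRightL_apply]
    rw [hβ.apply_pow_mul h1 hc hs hu, mul_add, Finset.mul_sum, bridgeKernel_comm u s]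
    congr 1
    · push_cast
      ring
    · exact Finset.sum_congr rfl fun k _ => by ring
  rw [integral_bridgeKernel_mul_eigenfunction j hu] at this
  simpa only [ContinuousLinearMap.comp_apply, mulRightL_apply] using this

/-- A second integration against the same eigenfunction, now in `u`, closes the recursion; the
normalisation of the eigenfunction gives the first term. -/
theorem IsFreeBrownianBridge.coordMoment_eq {φ : A →L[ℂ] ℂ} (h1 : φ 1 = 1) {β : ℝ → A}
    (hβ : IsFreeBrownianBridge φ 1 β) (hc : Continuous β) (j n : ℕ) :
    coordMoment φ β j n = bridgeEigenvalue j * φ (squareNorm β ^ n) +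
      ∑ k ∈ Finset.range n, φ (squareNorm β ^ k) *
        (bridgeEigenvalue j * coordMoment φ β j (n - 1 - k)) := by
  have hW : ∀ n, HasMean
      (fun u => bridgeEigenfunction j u * φ (bridgeCoord β j * (squareNorm β ^ n * β u)))
      (coordMoment φ β j n) := by
    intro n
    have := HasMean.apply_bridgeCoord
      (φ.comp (mulLeftL (bridgeCoord β j * squareNorm β ^ n))) hc j
    simpa only [ContinuousLinearMap.comp_apply, mulLeftL_apply, mul_assoc, coordMoment] using this
  have hR := ((HasMean.ofReal (f := fun u => bridgeEigenfunction j u * bridgeEigenfunction j u)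
      (by fun_prop)).const_mul (bridgeEigenvalue j * φ (squareNorm β ^ n))).add
    (HasMean.sum (Finset.range n) fun k => ((hW (n - 1 - k)).const_mul
      (bridgeEigenvalue j : ℂ)).const_mul (φ (squareNorm β ^ k)))
  have := (hW n).eq_of_eqOn hR fun u hu => by
    rw [hβ.apply_bridgeCoord_mul h1 hc j hu, mul_add, Finset.mul_sum]
    congr 1
    · push_cast
      ring
    · exact Finset.sum_congr rfl fun k _ => by ring
  rwa [integral_bridgeEigenfunction_mul, if_pos rfl, Complex.ofReal_one, mul_one] at this

theorem norm_bridgeCoord_le {β : ℝ → A} {C : ℝ} (hC : ∀ t ∈ Set.Icc (0 : ℝ) 1, ‖β t‖ ≤ C) (j : ℕ) :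
    ‖bridgeCoord β j‖ ≤ √2 * C := by
  have := intervalIntegral.norm_integral_le_of_norm_le_const (a := (0 : ℝ)) (b := 1)
    (f := fun t => bridgeEigenfunction j t • β t) (C := √2 * C) fun t ht => by
      rw [Set.uIoc_of_le zero_le_one] at ht
      rw [norm_smul]
      gcongr
      · exact abs_bridgeEigenfunction_le j t
      · exact hC t (Set.Ioc_subset_Icc_self ht)
  simpa [bridgeCoord] using this

theorem exists_norm_apply_mul_bridgeCoord_le (φ : A →L[ℂ] ℂ) {β : ℝ → A} (hc : Continuous β)
    (n : ℕ) : ∃ C, ∀ j, ∀ t ∈ Set.Icc (0 : ℝ) 1,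
      ‖φ (β t * (squareNorm β ^ n * bridgeCoord β j))‖ ≤ C := by
  obtain ⟨C, hC⟩ := exists_norm_le_of_continuous hc
  refine ⟨‖φ‖ * (C * (‖squareNorm β ^ n‖ * (√2 * C))), fun j t ht => ?_⟩
  have hC0 : 0 ≤ C := (norm_nonneg _).trans (hC t ht)
  refine (φ.le_opNorm _).trans ?_
  gcongr
  refine (norm_mul_le _ _).trans ?_
  gcongr
  · exact hC t ht
  refine (norm_mul_le _ _).trans ?_
  gcongr
  exact norm_bridgeCoord_le hC j

theorem summable_bridgeEigenvalue_pow_mul_coordMoment (φ : A →L[ℂ] ℂ) {β : ℝ → A}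
    (hc : Continuous β) {r : ℕ} (hr : 1 ≤ r) (n : ℕ) :
    Summable fun j => (bridgeEigenvalue j : ℂ) ^ r * coordMoment φ β j n := by
  obtain ⟨C, hC⟩ := exists_norm_le_of_continuous hc
  have hC0 : 0 ≤ C := (norm_nonneg _).trans (hC 0 (by simp))
  refine Summable.of_norm_bounded
    ((summable_bridgeEigenvalue_pow hr).mul_right
      (‖φ‖ * (√2 * C * (‖squareNorm β ^ n‖ * (√2 * C))))) fun j => ?_
  rw [norm_mul, norm_pow, Complex.norm_real, Real.norm_of_nonneg (bridgeEigenvalue_pos j).le]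
  have := (bridgeEigenvalue_pos j).le
  gcongr
  refine (φ.le_opNorm _).trans ?_
  gcongr
  refine (norm_mul_le _ _).trans ?_
  gcongr
  · exact norm_bridgeCoord_le hC j
  refine (norm_mul_le _ _).trans ?_
  gcongr
  exact norm_bridgeCoord_le hC j

/-- Expanding `bridgeConv β s` in eigenfunctions and integrating over `s` turns the remaining `β s`
into the same coordinate, so only diagonal moments occur and orthogonality of distinct coordinates
is not needed. -/
theorem hasMean_apply_bridgeConv (φ : A →L[ℂ] ℂ) {β : ℝ → A} (hc : Continuous β) (n : ℕ) :
    HasMean (fun s => φ (β s * squareNorm β ^ n * bridgeConv β s))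
      (∑' j, (bridgeEigenvalue j : ℂ) * coordMoment φ β j n) := by
  have hcc := continuous_bridgeConv hc
  refine ⟨by fun_prop, ?_⟩
  obtain ⟨C, hC⟩ := exists_norm_apply_mul_bridgeCoord_le φ hc n
  have h := hasSum_integral_of_bound (C := √2 * C)
    (F := fun j s => (bridgeEigenvalue j : ℂ) *
      (bridgeEigenfunction j s * φ (β s * (squareNorm β ^ n * bridgeCoord β j))))
    (f := fun s => φ (β s * squareNorm β ^ n * bridgeConv β s)) (fun j => by fun_prop)
    (fun j t ht => by
      rw [norm_mul, norm_mul, Complex.norm_real, Complex.norm_real,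
        Real.norm_of_nonneg (bridgeEigenvalue_pos j).le]
      have := (bridgeEigenvalue_pos j).le
      gcongr
      · exact abs_bridgeEigenfunction_le j t
      · exact hC j t ht)
    (fun s hs => by
      have := (hasSum_integral_bridgeKernel_smul hc hs).mapL
        (φ.comp (mulLeftL (β s * squareNorm β ^ n)))
      refine this.congr_fun fun j => ?_
      rw [← Complex.coe_smul, map_smul, smul_eq_mul, ContinuousLinearMap.comp_apply,
        mulLeftL_apply, mul_assoc (β s)]
      push_cast
      rw [mul_assoc]
      rfl)
  rw [← h.tsum_eq]
  refine tsum_congr fun j => ?_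
  have := (HasMean.apply_bridgeCoord
    (φ.comp (mulRightL (squareNorm β ^ n * bridgeCoord β j))) hc j).const_mul (bridgeEigenvalue j)
  exact this.2

theorem IsFreeBrownianBridge.apply_squareNorm_pow_succ {φ : A →L[ℂ] ℂ} (h1 : φ 1 = 1) {β : ℝ → A}
    (hβ : IsFreeBrownianBridge φ 1 β) (hc : Continuous β) (n : ℕ) :
    φ (squareNorm β ^ (n + 1)) = (spectralSum 1 : ℂ) * φ (squareNorm β ^ n) +
      ∑ k ∈ Finset.range n, φ (squareNorm β ^ k) *
        ∑' j, (bridgeEigenvalue j : ℂ) * coordMoment φ β j (n - 1 - k) := by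
  have hL := HasMean.apply (φ.comp (mulRightL (squareNorm β ^ n))) (hc.pow 2)
  have hck := continuous_bridgeKernel
  have hR := ((HasMean.ofReal (f := fun s => bridgeKernel s s) (by fun_prop)).const_mul
    (φ (squareNorm β ^ n))).add
    (HasMean.sum (Finset.range n) fun k => (hasMean_apply_bridgeConv φ hc k).const_mul
      (φ (squareNorm β ^ (n - 1 - k))))
  have := hL.eq_of_eqOn hR fun s hs => by
    have e : φ.comp (mulRightL (squareNorm β ^ n)) ((β ^ 2) s) =
        φ (β s * (β s * squareNorm β ^ n)) := by
      simp [pow_two, mul_assoc]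
    rw [e, hβ.apply_mul_pow h1 hc hs, mul_comm]
  -- The integrated identity carries the power `n - 1 - k` outside and `k` inside the coordinate
  -- moment; reflecting the sum exchanges them.
  rw [← Finset.sum_range_reflect, pow_succ']
  rw [integral_bridgeKernel_diag, mul_comm (φ _)] at this
  refine Eq.trans this (congrArg₂ (· + ·) rfl (Finset.sum_congr rfl fun k hk => ?_))
  rw [Finset.mem_range] at hk
  rw [show n - 1 - (n - 1 - k) = k by omega]

/-- The moments of the square norm of a free Brownian bridge. -/
theorem IsFreeBrownianBridge.apply_squareNorm_pow {φ : A →L[ℂ] ℂ} (h1 : φ 1 = 1) {β : ℝ → A}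
    (hβ : IsFreeBrownianBridge φ 1 β) (hc : Continuous β) (n : ℕ) :
    φ (squareNorm β ^ n) = ∑ σ ∈ NC n, ∏ V ∈ σ.parts, (spectralSum V.card : ℂ) := by
  have hκ : ∀ m, 1 ≤ m → HasSum (fun j => (bridgeEigenvalue j : ℂ) ^ m) (spectralSum m : ℂ) := by
    intro m hm
    have := Complex.hasSum_ofReal.2 (summable_bridgeEigenvalue_pow hm).hasSum
    rw [tsum_bridgeEigenvalue_pow] at this
    simpa using this
  have key := (ncSum_Ico_card (κ := fun m => (spectralSum m : ℂ))
    (M := fun n => φ (squareNorm β ^ n))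
    (t := fun r n => ∑' j, (bridgeEigenvalue j : ℂ) ^ r * coordMoment φ β j n) (by simp [h1])
    (fun n => by simpa using hβ.apply_squareNorm_pow_succ h1 hc n) (fun r hr n => by
      -- Multiply the recursion for `coordMoment` by the `r`-th power of the eigenvalue and sum over
      -- `j`: the extra eigenvalue raises `r` to `r + 1`.
      refine HasSum.tsum_eq ?_
      have hs := ((hκ (r + 1) (by omega)).mul_right (φ (squareNorm β ^ n))).add
        (hasSum_sum (s := Finset.range n) fun k _ =>
          ((summable_bridgeEigenvalue_pow_mul_coordMoment φ hc (show 1 ≤ r + 1 by omega)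
            (n - 1 - k)).hasSum.mul_left (φ (squareNorm β ^ k))))
      refine hs.congr_fun fun j => ?_
      rw [hβ.coordMoment_eq h1 hc, mul_add, Finset.mul_sum]
      congr 1
      · ring
      · exact Finset.sum_congr rfl fun k _ => by ring) n).1 0
  rw [← key, sum_NC_eq_ncSum (fun V => (spectralSum V.card : ℂ)), ← map_finShift_univ, ncSum_map]
  simp only [Finset.card_map]

/-- The free cumulants are determined by the moments. -/
theorem freeCumulantOf_eq_of_moments {φ : A →L[ℂ] ℂ} {a : A} {κ : ℕ → ℂ}
    (h : ∀ n, 1 ≤ n → φ (a ^ n) = ∑ σ ∈ NC n, ∏ V ∈ σ.parts, κ V.card) {m : ℕ} (hm : 1 ≤ m) :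
    freeCumulantOf φ m a = κ m := by
  classical
  induction m using Nat.strong_induction_on with
  | _ m ih =>
    have hne : (Finset.univ : Finset (Fin m)) ≠ ⊥ := by
      have : NeZero m := ⟨by omega⟩
      exact Finset.univ_nonempty.ne_empty
    have h1 : (NC m).filter (fun π => π.parts = {Finset.univ}) =
        {Finpartition.indiscrete hne} := by
      ext π
      simp only [Finset.mem_filter, Finset.mem_singleton, NC, Finset.mem_univ, true_and]
      constructor
      · rintro ⟨-, h⟩
        exact Finpartition.ext h
      · rintro rfl
        refine ⟨fun V hV W hW hVW => ?_, rfl⟩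
        simp only [Finpartition.indiscrete, Finset.mem_singleton] at hV hW
        exact absurd (hV.trans hW.symm) hVW
    have h2 := h m hm
    have h3 : φ (a ^ m) = φ (List.ofFn fun _ : Fin m => a).prod := by simp
    rw [h3, moment_eq_sum_freeCumulant φ hm,
      ← Finset.sum_filter_add_sum_filter_not (NC m) (fun π => π.parts = {Finset.univ}),
      ← Finset.sum_filter_add_sum_filter_not (NC m) (fun π => π.parts = {Finset.univ})
        (fun π => ∏ V ∈ π.parts, κ V.card), h1, Finset.sum_singleton, Finset.sum_singleton] at h2
    have h4 : ∀ π ∈ (NC m).filter (fun π => ¬ π.parts = {Finset.univ}),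
        ∏ V ∈ π.parts, freeCumulant φ V.card (fun _ => a) = ∏ V ∈ π.parts, κ V.card := by
      intro π hπ
      refine Finset.prod_congr rfl fun V hV => ?_
      refine ih V.card ?_ (Finset.card_pos.2 (π.nonempty_of_mem_parts hV))
      by_contra hcon
      have hVu : V = Finset.univ := by
        rw [← Finset.card_eq_iff_eq_univ, Fintype.card_fin]
        have := Finset.card_le_univ V
        rw [Fintype.card_fin] at this
        omega
      subst hVu
      refine (Finset.mem_filter.1 hπ).2 (Finset.eq_singleton_iff_unique_mem.2 ⟨hV, fun W hW => ?_⟩)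
      obtain ⟨x, hx⟩ := π.nonempty_of_mem_parts hW
      exact π.eq_of_mem_parts hW hV hx (Finset.mem_univ x)
    rw [Finset.sum_congr rfl h4] at h2
    rw [freeCumulantOf, ← freeCumulant_block_univ φ fun _ : Fin m => a]
    simpa [Finpartition.indiscrete] using h2

end BridgeMoments

/-! ### Reduction to continuous paths on the real line, and conclusion -/

theorem IsFreeBrownianBridge.congr {A : Type*} [CStarAlgebra A] {φ : A →L[ℂ] ℂ} {T : ℝ}
    {β β' : ℝ → A} (hβ : IsFreeBrownianBridge φ T β) (h : Set.EqOn β' β (Set.Icc 0 T)) :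
    IsFreeBrownianBridge φ T β' := by
  refine ⟨fun n t ht => ?_, fun s hs t ht => ?_⟩
  · have e : ∀ p, β' (t p) = β (t p) := fun p => h (ht p)
    simp only [e]
    exact hβ.semicircular n t ht
  · rw [h hs, h ht]
    exact hβ.covariance s hs t ht

theorem IsFreeBrownianBridge.exists_continuous {A : Type*} [CStarAlgebra A] {φ : A →L[ℂ] ℂ}
    {β : ℝ → A} (hβ : IsFreeBrownianBridge φ 1 β) (hc : ContinuousOn β (Set.Icc 0 1)) :
    ∃ β' : ℝ → A, IsFreeBrownianBridge φ 1 β' ∧ Continuous β' ∧ squareNorm β' = squareNorm β := by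
  have h : Set.EqOn (Set.IccExtend zero_le_one ((Set.Icc (0 : ℝ) 1).domRestrict β)) β
      (Set.Icc 0 1) := fun t ht => Set.IccExtend_of_mem _ _ ht
  -- Extend `β` by its endpoint values outside `[0, 1]`; neither the bridge property nor the
  -- integral sees the change.
  refine ⟨_, hβ.congr h, (continuousOn_iff_continuous_domRestrict.1 hc).Icc_extend', ?_⟩
  refine intervalIntegral.integral_congr fun t ht => ?_
  rw [Set.uIcc_of_le zero_le_one] at ht
  simp only [h ht]

theorem sum_card_parts {n : ℕ} (σ : Finpartition (Finset.univ : Finset (Fin n))) :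
    ∑ V ∈ σ.parts, V.card = n := by
  rw [σ.sum_card_parts, Finset.card_univ, Fintype.card_fin]

theorem mainTheorem1 {A : Type*} [CStarAlgebra A] (φ : A →L[ℂ] ℂ) (hφ : IsState φ)
    (β : ℝ → A) (hβ : IsFreeBrownianBridge φ 1 β) :
    -- for a faithful state, `β` is norm continuous, so that `Γ` is defined
    (IsFaithfulFunctional φ → ContinuousOn β (Set.Icc 0 1)) ∧
    -- whenever `β` is norm continuous:
    (ContinuousOn β (Set.Icc 0 1) →
      -- the R-transform of `Γ`, where `w` is any square root of `z`
      (∀ z w : ℂ, 0 < ‖z‖ → ‖z‖ < Real.pi ^ 2 → w ^ 2 = z →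
        HasSum (fun n : ℕ => PowerSeries.coeff n (rTransform φ (squareNorm β)) * z ^ n)
          ((1 - w * Complex.cot w) / (2 * z))) ∧
      -- the free cumulants of `Γ`
      (∀ m : ℕ, 1 ≤ m →
        freeCumulantOf φ m (squareNorm β) = riemannZeta (2 * (m : ℂ)) / (Real.pi : ℂ) ^ (2 * m) ∧
        freeCumulantOf φ m (squareNorm β) =
          -(1 / 2) * (-4) ^ m * (bernoulli (2 * m) : ℂ) / ((2 * m).factorial : ℂ)) ∧
      -- the moments of `Γ`
      (∀ n : ℕ,
        φ (squareNorm β ^ n) =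
          1 / (Real.pi : ℂ) ^ (2 * n) *
            ∑ σ ∈ NC n, ∏ V ∈ σ.parts, riemannZeta (2 * (V.card : ℂ)) ∧
        φ (squareNorm β ^ n) =
          (-4) ^ n * ∑ σ ∈ NC n, ∏ V ∈ σ.parts,
            (-(1 / 2) * (bernoulli (2 * V.card) : ℂ) / ((2 * V.card).factorial : ℂ)))) := by
  refine ⟨fun hf => hβ.continuousOn hφ hf, fun hc => ?_⟩
  obtain ⟨β', hβ', hc', hΓ⟩ := hβ.exists_continuous hc
  have hmom : ∀ n, φ (squareNorm β ^ n) = ∑ σ ∈ NC n, ∏ V ∈ σ.parts, (spectralSum V.card : ℂ) :=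
    fun n => hΓ ▸ hβ'.apply_squareNorm_pow hφ.map_one hc' n
  have hcum : ∀ m, 1 ≤ m → freeCumulantOf φ m (squareNorm β) = (spectralSum m : ℂ) := fun m hm =>
    freeCumulantOf_eq_of_moments (κ := fun m => (spectralSum m : ℂ)) (fun n _ => hmom n) hm
  refine ⟨fun z w hz0 hz hw => ?_, fun m hm => ?_, fun n => ?_⟩
  · simp only [rTransform, PowerSeries.coeff_mk]
    simpa only [hcum _ (Nat.succ_pos _)] using hasSum_spectralSum_mul_pow hz0 hz hw
  · rw [hcum m hm, ofReal_spectralSum hm]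
    exact ⟨rfl, zeta_div_pi_pow_eq_bernoulli hm⟩
  · have hpos : ∀ σ : Finpartition (Finset.univ : Finset (Fin n)), ∀ V ∈ σ.parts, 1 ≤ V.card :=
      fun σ V hV => Finset.card_pos.2 (σ.nonempty_of_mem_parts hV)
    rw [hmom, Finset.mul_sum, Finset.mul_sum]
    constructor
    · refine Finset.sum_congr rfl fun σ _ => ?_
      rw [Finset.prod_congr rfl fun V hV => ofReal_spectralSum (hpos σ V hV), Finset.prod_div_distrib,
        Finset.prod_pow_eq_pow_sum, ← Finset.mul_sum, sum_card_parts]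
      ring
    · refine Finset.sum_congr rfl fun σ _ => ?_
      rw [Finset.prod_congr rfl fun V hV => (ofReal_spectralSum (hpos σ V hV)).trans
        (zeta_div_pi_pow_eq_bernoulli (hpos σ V hV))]
      -- The block sizes add up to `n`, so the power distributes over the blocks.
      have e : (-4 : ℂ) ^ n = ∏ V ∈ σ.parts, (-4 : ℂ) ^ V.card := by
        rw [Finset.prod_pow_eq_pow_sum, sum_card_parts]
      rw [e, ← Finset.prod_mul_distrib]
      exact Finset.prod_congr rfl fun V _ => by ring
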